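/- \textbf{Theorem (order finding over a black-box group).} \emph{Setting.} Let $B$ be a finite abelian group whose elements are uniquely encoded by $n$-bit strings, and let $\mathbb T=\mathbb R/\mathbb Z$. States of $\mathcal H_{\mathbb Z}\otimes\mathcal H_B$ are represented either in the basis labelled by $\mathbb Z\times B$, as wavefunctions in $\ell^2(\mathbb Z\times B)$, or in the Fourier basis labelled by $\mathbb T\times B$, as wavefunctions in $L^2(\mathbb T\times B)$; the two are related by $\hat\psi(p,b)=\sum_{x\in\mathbb Z}e^{2\pi i px}\psi(x,b)$. A normalizer circuit over $\mathbb Z\times B$ is a sequence of gates, each an automorphism gate $|g\rangle\mapsto|\alpha(g)\rangle$ ($\alpha$ a continuous automorphism) or a quadratic phase gate $|g\rangle\mapsto\xi(g)|g\rangle$ ($\xi$ a continuous quadratic function) over the label group of the current basis, or a quantum Fourier transform $\mathcal F_{\mathbb Z}$, $\mathcal F_{\mathbb T}$ that changes the current basis from $\mathbb Z\times B$ to $\mathbb T\times B$, respectively back. Each gate takes one time step. In particular the automorphism gate $c\text{-}V_a:|m,x\rangle\mapsto|m,a^mx\rangle$ can be queried in one time step for each $a\in B$. For $a\in B$ and $M\in\mathbb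 N$, let the \emph{order-finding circuit} be $\mathcal F_{\mathbb T}$, then $c\text{-}V_a$, then $\mathcal F_{\mathbb Z}$, started in the approximate Fourier state $|\tilde 0\rangle\otimes|1\rangle$, $|\tilde 0\rangle=(2M+1)^{-1/2}\sum_{m=-M}^{M}|m\rangle$. Its final state is measured in the basis labelled by $\mathbb T\times B$. Measuring at resolution $d$ (and discarding the $B$ register) returns the $i\in\{0,\dots,d-1\}$ whose sector $\{p\in\mathbb T:\ \mathrm{dist}(p,i/d)<1/(2d)\}$ contains the outcome $p$. From outcomes $i_1,\dots,i_t$ of $t$ independent runs, output $\operatorname{lcm}_j s_j$, where $s_j$ is the largest denominator not exceeding $2^n$ of a continued-fraction convergent of $i_j/d$. Classical programs run on a random access machine over $\mathbb N$ with $+$, truncated $-$, $\times$, quotient and remainder, whose instructions cost one plus the number of bits of the numbers they handle. \emph{Part 1.} There are two fixed classical programs, a preprocessing and a post-processing program, and a polynomial $q$, such that for all $n,k\in\mathbb N$ the following holds. The preprocessing program, on input $(n,k)$, halts and outputs $M$, $d\ge 1$ and $t$. For all $i_1,\dots,i_t\in\{0,\dots,d-1\}$ the post-processing program, on input $(n,k,M,d,t;i_1,\dots,i_t)$,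 halts and outputs the above least common multiple. And for every finite abelian group $B$ with an $n$-bit encoding: \begin{enumerate} \item (polynomial time) the total time, that is, the cost of both programs (for the worst outcomes) plus, for each of the $t$ runs, one step for the preparation, one for each gate and one for the measurement, is at most $q(n+k)$; \item (efficient precision) $\log_2 d$ and $\log_2 M$, rounded down (and read as $0$ if $M=0$), are at most $q(n+k)$, and $|\tilde0\rangle\otimes|1\rangle$ is a $d$-approximate Fourier state up to fidelity $2/3$: its projection onto the wavefunctions supported on the sector $i=0$ and on $1\in B$ has squared norm at least $2/3$; \item (success) for every $a\in B$, the output of the algorithm is the order $|a|$ of $a$ with probability at least $1-2^{-k}$. \end{enumerate} \emph{Part 2.} Let $B$ be any finite abelian group, $a,x\in B$, $r=|a|$, $M\in\mathbb N$, $k\in\mathbb Z$ and $L=\#\{m\in\mathbb Z: |m|\le M,\ a^m=x\}$, with $L\geq 1$. The measurement of the final state of the order-finding circuit for $a$ and $M$ in the basis labelled by $\mathbb T\times B$ yields, with probability at least $\frac{L}{2M+1}\cdot\frac{4}{\pi^2 r}$, an outcome $(p,x)$ with $\mathrm{dist}(p,k/r)\le\frac1{2Lr}$. -/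

import Mathlib

open MeasureTheory
open scoped ENNReal ComplexConjugate

noncomputable section

namespace BBN

/-! ## The registers `ℤ × B` and `𝕋 × B` -/

/-- The finite abelian group `B`, written additively, with the discrete topology and the discrete
measurable structure. -/
def BReg (B : Type*) : Type _ := Additive B

instance (B : Type*) [CommGroup B] : AddCommGroup (BReg B) :=
  inferInstanceAs (AddCommGroup (Additive B))
instance (B : Type*) [Finite B] : Finite (BReg B) := inferInstanceAs (Finite (Additive B))
instance (B : Type*) : TopologicalSpace (BReg B) := ⊥
instance (B : Type*) : DiscreteTopology (BReg B) := ⟨rfl⟩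
instance (B : Type*) : MeasurableSpace (BReg B) := ⊤
instance (B : Type*) : DiscreteMeasurableSpace (BReg B) := ⟨fun _ => trivial⟩
instance (B : Type*) : BorelSpace (BReg B) := ⟨borel_eq_top_of_discrete.symm⟩

/-- An element of `B`, as a label of the register. -/
def BReg.of {B : Type*} (b : B) : BReg B := Additive.ofMul b

/-- The label group `ℤ × B`. -/
abbrev GZ (B : Type*) : Type _ := ℤ × BReg B

/-- The label group `𝕋 × B`, with `𝕋 = ℝ / ℤ`. -/
abbrev GT (B : Type*) : Type _ := UnitAddCircle × BReg B

/-- Haar measure on `𝕋 × B` (total mass one on the circle, counting measure on `B`). -/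
def haarT (B : Type*) : Measure (GT B) :=
  (AddCircle.haarAddCircle (T := (1 : ℝ))).prod Measure.count

/-- `ℋ_ℤ ⊗ ℋ_B` in the group-element basis labelled by `ℤ × B`: wavefunctions in `ℓ²(ℤ × B)`. -/
abbrev HZ (B : Type*) : Type _ := lp (fun _ : GZ B => ℂ) 2

/-- `ℋ_ℤ ⊗ ℋ_B` in the group-element basis labelled by `𝕋 × B`: wavefunctions in `L²(𝕋 × B)`. -/
abbrev HT (B : Type*) : Type _ := Lp ℂ 2 (haarT B)

instance (B : Type*) [Finite B] : IsFiniteMeasure (haarT B) := by unfold haarT; infer_instance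

/-! ## The Fourier transform of the register `ℋ_ℤ` -/

section fourier

lemma map_slice (B : Type*) (b : BReg B) :
    (AddCircle.haarAddCircle (T := (1 : ℝ))).map (fun t => (t, b)) =
      (AddCircle.haarAddCircle (T := (1 : ℝ))).prod (Measure.dirac b) :=
  (Measure.prod_dirac b).symm

variable (B : Type*) [Finite B]

open Classical in
/-- The function `(p, b') ↦ e^{2πi x p} 1_{b' = b}` on `𝕋 × B`: the wavefunction, in the basis
labelled by `𝕋 × B`, of the standard basis state `|x, b⟩`. -/
def charFun (g : GZ B) (h : GT B) : ℂ := if h.2 = g.2 then fourier g.1 h.1 else 0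

variable {B} in
lemma charFun_memLp (g : GZ B) : MemLp (charFun B g) 2 (haarT B) := by
  refine MemLp.of_bound (C := 1) ?_ (Filter.Eventually.of_forall fun h => ?_)
  · refine Measurable.aestronglyMeasurable ?_
    unfold charFun
    refine Measurable.ite ?_ ?_ measurable_const
    · exact measurable_snd (MeasurableSet.of_discrete (s := {g.2}))
    · exact (map_continuous (fourier g.1)).measurable.comp measurable_fst
  · unfold charFun
    split_ifs with h
    · rw [fourier_apply]; exact (Circle.norm_coe _).le
    · simp

variable {B} in
/-- `charFun` as an element of `L²(𝕋 × B)`. -/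
def charVec (g : GZ B) : HT B := (charFun_memLp g).toLp

lemma prod_dirac_le (b : BReg B) :
    (AddCircle.haarAddCircle (T := (1 : ℝ))).prod (Measure.dirac b) ≤ haarT B := by
  refine Measure.prod_mono le_rfl ?_
  intro s
  by_cases h : b ∈ s
  · rw [Measure.dirac_apply_of_mem h, Measure.count_apply (MeasurableSet.of_discrete)]
    exact_mod_cast Set.one_le_encard_iff_nonempty.mpr ⟨b, h⟩
  · have : Measure.dirac b s = 0 := by
      rw [Measure.dirac_apply' _ MeasurableSet.of_discrete]; simp [h]
    rw [this]; simp

variable {B} in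
lemma slice_memLp (f : HT B) (b : BReg B) :
    MemLp (fun t => f (t, b)) 2 (AddCircle.haarAddCircle (T := (1 : ℝ))) := by
  have h1 : MemLp f 2 ((AddCircle.haarAddCircle (T := (1 : ℝ))).map (fun t => (t, b))) := by
    rw [map_slice]
    exact (Lp.memLp f).mono_measure (prod_dirac_le B b)
  exact h1.comp_of_map (by fun_prop)

lemma ae_haarT_iff {P : GT B → Prop} (hP : ∀ b, ∀ᵐ t ∂(AddCircle.haarAddCircle (T := (1 : ℝ))),
    P (t, b)) : ∀ᵐ g ∂(haarT B), P g := by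
  have h : haarT B = Measure.sum
      (fun b : BReg B => (AddCircle.haarAddCircle (T := (1 : ℝ))).map (fun t => (t, b))) := by
    simp_rw [map_slice, haarT]
    rw [← Measure.prod_sum_right]
    rfl
  rw [h, Measure.ae_sum_iff]
  intro b
  exact (MeasurableEmbedding.ae_map_iff
    (MeasurableEmbedding.of_measurable_inverse (g := Prod.fst) (by fun_prop)
      (by
        have : Set.range (fun t : UnitAddCircle => (t, b)) = Prod.snd ⁻¹' {b} := by
          ext ⟨t, c⟩; simp [eq_comm]
        rw [this]; exact measurable_snd (MeasurableSet.of_discrete))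
      (by fun_prop) (fun t => rfl))).mpr (hP b)

lemma inner_charVec (g : GZ B) (f : HT B) :
    inner ℂ (charVec g) f = fourierCoeff (fun t => f (t, g.2)) g.1 := by
  classical
  have := Fintype.ofFinite (BReg B)
  rw [L2.inner_def]
  have hae : (fun a => inner ℂ ((charVec g : HT B) a) (f a)) =ᵐ[haarT B]
      fun a => inner ℂ (charFun B g a) (f a) := by
    filter_upwards [(charFun_memLp g).coeFn_toLp] with a ha
    have : (charVec g : HT B) a = charFun B g a := ha
    rw [this]
  have hint := (L2.integrable_inner (𝕜 := ℂ) (charVec g) f).congr hae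
  rw [integral_congr_ae hae]
  unfold haarT at hint ⊢
  rw [integral_prod_symm _ hint, integral_count]
  rw [Finset.sum_eq_single g.2]
  · simp only [fourierCoeff, charFun, if_true, fourier_neg, smul_eq_mul]
    refine integral_congr_ae (Filter.Eventually.of_forall fun t => ?_)
    simp [mul_comm]
  · intro b _ hb
    simp [charFun, hb]
  · intro h; exact absurd (Finset.mem_univ _) h

lemma orthonormal_charVec : Orthonormal ℂ (charVec (B := B)) := by
  classical
  rw [orthonormal_iff_ite]
  rintro ⟨x, b⟩ ⟨y, c⟩
  rw [inner_charVec]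
  have h : (fun t => (charVec (y, c) : HT B) (t, b)) =ᵐ[AddCircle.haarAddCircle (T := (1 : ℝ))]
      fun t => charFun B (y, c) (t, b) := by
    have h0 : ∀ᵐ a ∂(haarT B), (charVec (y, c) : HT B) a = charFun B (y, c) a :=
      (charFun_memLp (y, c)).coeFn_toLp
    have h1 := (Measure.absolutelyContinuous_of_le (prod_dirac_le B b)).ae_le h0
    rw [← map_slice] at h1
    exact ae_of_ae_map (by fun_prop) h1
  rw [fourierCoeff_congr_ae h]
  by_cases hbc : b = c
  · subst hbc
    have h2 := orthonormal_iff_ite.mp (orthonormal_fourier (T := (1 : ℝ))) x y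
    have h3 := fourierBasis_repr (T := (1 : ℝ)) (fourierLp 2 y) x
    rw [HilbertBasis.repr_apply_apply, coe_fourierBasis, h2,
      fourierCoeff_congr_ae (coeFn_fourierLp 2 y)] at h3
    simpa only [charFun, if_true, Prod.mk.injEq, and_true] using h3.symm
  · simp [charFun, hbc, fourierCoeff]

lemma charVec_complete :
    (Submodule.span ℂ (Set.range (charVec (B := B))))ᗮ = ⊥ := by
  rw [Submodule.eq_bot_iff]
  intro f hf
  rw [Submodule.mem_orthogonal] at hf
  have hz : ∀ g : GZ B, fourierCoeff (fun t => f (t, g.2)) g.1 = 0 := fun g => by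
    rw [← inner_charVec]
    exact hf _ (Submodule.subset_span ⟨g, rfl⟩)
  have hae : ∀ᵐ g ∂(haarT B), f g = 0 := by
    refine ae_haarT_iff B fun b => ?_
    have hF : (slice_memLp f b).toLp = 0 := by
      apply (fourierBasis (T := (1 : ℝ))).repr.injective
      ext x
      rw [fourierBasis_repr, map_zero]
      rw [fourierCoeff_congr_ae (slice_memLp f b).coeFn_toLp]
      exact hz (x, b)
    have := (slice_memLp f b).coeFn_toLp
    rw [hF] at this
    filter_upwards [this, Lp.coeFn_zero ℂ 2 (AddCircle.haarAddCircle (T := (1 : ℝ)))] with t h1 h2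
    rw [← h1, h2]; rfl
  exact (Lp.eq_zero_iff_ae_eq_zero).mpr hae

/-- The Hilbert basis `|x, b⟩`, `(x, b) ∈ ℤ × B`, of `ℋ_ℤ ⊗ ℋ_B` in the `𝕋 × B` picture. Its
coordinate map is the unitary that re-expresses a state in the other group-element basis. -/
def fourierB : HilbertBasis (GZ B) ℂ (HT B) :=
  HilbertBasis.mkOfOrthogonalEqBot (orthonormal_charVec B) (charVec_complete B)

end fourier

section instances
variable (B : Type*) [CommGroup B] [Finite B]

instance : IsTopologicalAddGroup (BReg B) where
  continuous_add := continuous_of_discreteTopology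
  continuous_neg := continuous_of_discreteTopology

instance : (Measure.count : Measure (BReg B)).IsAddHaarMeasure where
  lt_top_of_isCompact := fun _ _ => measure_lt_top _ _
  open_pos := fun U _ hU => by
    rw [Measure.count_apply MeasurableSet.of_discrete]
    simpa [Set.nonempty_iff_ne_empty] using hU

instance : (haarT B).IsAddHaarMeasure := by unfold haarT; infer_instance

end instances

/-! ## Normalizer gates and circuits over `ℤ × B` -/

/-- The two possible designated group-element bases of `ℋ_ℤ ⊗ ℋ_B`: the one labelled by `ℤ × B`
and the one labelled by `𝕋 × B`. -/
inductive Label : Type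
  | Z : Label
  | T : Label

/-- A character: a continuous homomorphism to the unit circle. -/
def IsChar {G : Type*} [AddCommGroup G] [TopologicalSpace G] (χ : G → Circle) : Prop :=
  Continuous χ ∧ ∀ g h, χ (g + h) = χ g * χ h

/-- A quadratic function: continuous, with `ξ (g + h) = ξ g * ξ h * β g h` for a bicharacter. -/
def IsQuadratic {G : Type*} [AddCommGroup G] [TopologicalSpace G] (ξ : G → Circle) : Prop :=
  Continuous ξ ∧ ∃ β : G → G → Circle,
    (∀ g, IsChar (β g)) ∧ (∀ h, IsChar fun g => β g h) ∧
      ∀ g h, ξ (g + h) = ξ g * ξ h * β g h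

/-- Normalizer gates: automorphism gates, quadratic phase gates and quantum Fourier transforms. The
first two do not change the designated basis; the Fourier transforms do. -/
inductive Gate (B : Type*) [CommGroup B] : Label → Label → Type _
  | autoZ (α : GZ B ≃+ GZ B) : Gate B .Z .Z
  | autoT (α : GT B ≃ₜ+ GT B) : Gate B .T .T
  | phaseZ (ξ : GZ B → Circle) (hξ : IsQuadratic ξ) : Gate B .Z .Z
  | phaseT (ξ : GT B → Circle) (hξ : IsQuadratic ξ) : Gate B .T .T
  | qftZ : Gate B .Z .T
  | qftT : Gate B .T .Z

/-- Wavefunctions of `ℋ_ℤ ⊗ ℋ_B` in the designated basis. -/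
def State (B : Type*) : Label → Type _
  | .Z => HZ B
  | .T => HT B

lemma memlp_comp {B : Type*} [CommGroup B] (α : GZ B ≃+ GZ B) (ψ : HZ B) :
    Memℓp (fun g => ψ (α.symm g)) 2 := by
  have h := (memℓp_gen_iff (by norm_num)).mp (lp.memℓp ψ)
  exact memℓp_gen (h.comp_injective α.symm.injective)

lemma memlp_phase {B : Type*} (ξ : GZ B → Circle) (ψ : HZ B) :
    Memℓp (fun g => (ξ g : ℂ) * ψ g) 2 := by
  have h := (memℓp_gen_iff (by norm_num)).mp (lp.memℓp ψ)
  refine memℓp_gen ?_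
  simpa only [norm_mul, Circle.norm_coe, one_mul] using h

lemma measurePreserving_auto {B : Type*} [CommGroup B] [Finite B] (α : GT B ≃ₜ+ GT B) :
    MeasurePreserving (fun g => α.symm g) (haarT B) (haarT B) :=
  AddMonoidHom.measurePreserving (f := (α.symm.toAddEquiv : GT B →+ GT B))
    α.symm.continuous α.symm.surjective rfl

lemma memLp_phase {B : Type*} [CommGroup B] [Finite B] (ξ : GT B → Circle) (hξ : IsQuadratic ξ)
    (ψ : HT B) : MemLp (fun g => (ξ g : ℂ) * ψ g) 2 (haarT B) := by
  refine (Lp.memLp ψ).congr_norm ?_ (Filter.Eventually.of_forall fun g => ?_)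
  · exact (continuous_subtype_val.comp hξ.1).aestronglyMeasurable.mul
      (Lp.aestronglyMeasurable ψ)
  · rw [norm_mul, Circle.norm_coe, one_mul]

/-- The action of a gate on wavefunctions: `|g⟩ ↦ |α g⟩` for automorphism gates, `|g⟩ ↦ ξ(g) |g⟩` for
quadratic phase gates, and the change of group-element basis for Fourier transforms; thus `qftZ`
sends `ψ` to `ψ̂(p, b) = ∑ₓ e^{2πi p x} ψ(x, b)`, and `qftT` is its inverse. -/
def Gate.apply {B : Type*} [CommGroup B] [Finite B] :
    {l l' : Label} → Gate B l l' → State B l → State B l'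
  | _, _, .autoZ α => fun ψ : HZ B => (⟨fun g => ψ (α.symm g), memlp_comp α ψ⟩ : HZ B)
  | _, _, .autoT α => fun ψ : HT B =>
      (((Lp.memLp ψ).comp_measurePreserving (measurePreserving_auto α)).toLp : HT B)
  | _, _, .phaseZ ξ _ => fun ψ : HZ B => (⟨fun g => (ξ g : ℂ) * ψ g, memlp_phase ξ ψ⟩ : HZ B)
  | _, _, .phaseT ξ hξ => fun ψ : HT B => ((memLp_phase ξ hξ ψ).toLp : HT B)
  | _, _, .qftZ => fun ψ : HZ B => ((fourierB B).repr.symm ψ : HT B)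
  | _, _, .qftT => fun ψ : HT B => ((fourierB B).repr ψ : HZ B)

/-- A normalizer circuit over `ℤ × B`: a finite sequence of normalizer gates, each of which is a
gate for the designated basis at its time step. -/
inductive Circuit (B : Type*) [CommGroup B] : Label → Label → Type _
  | nil {l : Label} : Circuit B l l
  | cons {l l' l'' : Label} (U : Gate B l l') (C : Circuit B l' l'') : Circuit B l l''

/-- The number of gates of a circuit; every gate takes one time step. -/
def Circuit.size {B : Type*} [CommGroup B] : {l l' : Label} → Circuit B l l' → ℕ
  | _, _, .nil => 0
  | _, _, .cons _ C => 1 + C.size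

/-- The time of one quantum round: one step to prepare the input state, one step for each gate (in
particular for each query), and one step for the final measurement. -/
def Circuit.time {B : Type*} [CommGroup B] {l l' : Label} (C : Circuit B l l') : ℕ :=
  C.size + 2

/-- The action of a circuit on wavefunctions. -/
def Circuit.run {B : Type*} [CommGroup B] [Finite B] :
    {l l' : Label} → Circuit B l l' → State B l → State B l'
  | _, _, .nil => fun ψ => ψ
  | _, _, .cons U C => fun ψ => C.run (U.apply ψ)

/-! ## Approximate Fourier states and finite-resolution measurements -/

/-- The distribution of the outcome of a measurement of `ψ` in the basis labelled by `𝕋 × B`: it has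
density `|ψ|²` with respect to Haar measure. -/
def measureT {B : Type*} (ψ : HT B) : Measure (GT B) :=
  (haarT B).withDensity fun g => ‖ψ g‖ₑ ^ 2

/-- The `i`-th of the `d` sectors of `𝕋`: the points at distance less than `1 / (2d)` from `i / d`. -/
def sector (d i : ℕ) : Set UnitAddCircle :=
  {p | ‖p - (((i : ℝ) / d : ℝ) : UnitAddCircle)‖ < 1 / (2 * d)}

/-- The probability that a measurement of `ψ` in the basis labelled by `𝕋 × B`, with resolution `d`
and with the outcome of the register `ℋ_B` discarded, yields the sector `i`. -/
def outcomeProb {B : Type*} (ψ : HT B) (d i : ℕ) : ℝ :=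
  (measureT ψ).real {g | g.1 ∈ sector d i}

/-- `ψ` has fidelity at least `2/3` with a `d`-approximate Fourier state `|i/d + Δ⟩ ⊗ |b⟩`: its
projection to the wavefunctions supported on the `i`-th sector (and on `b`) has squared norm at
least `2/3`. -/
def IsApproxFourierState {B : Type*} (d i : ℕ) (b : B) (ψ : HT B) : Prop :=
  2 / 3 ≤ (measureT ψ).real {g | g.1 ∈ sector d i ∧ g.2 = BReg.of b}

open Classical in
/-- The square pulse `(2M+1)^{-1/2} ∑_{m=-M}^{M} |m⟩ ⊗ |1⟩`, in the basis labelled by `ℤ × B`. -/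
def pulse (B : Type*) [CommGroup B] (M : ℕ) : HZ B :=
  ((1 / Real.sqrt (2 * M + 1) : ℝ) : ℂ) •
    ∑ m ∈ Finset.Icc (-(M : ℤ)) M, lp.single 2 ((m, BReg.of 1) : GZ B) (1 : ℂ)

/-- The same state in the basis labelled by `𝕋 × B`: the approximation of the (unphysical) basis
state `|0⟩ ⊗ |1⟩`, `0 ∈ 𝕋`, `1 ∈ B`. -/
def approxZero (B : Type*) [CommGroup B] [Finite B] (M : ℕ) : HT B :=
  (fourierB B).repr.symm (pulse B M)

/-! ## The order-finding circuit -/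

/-- The automorphism `(m, x) ↦ (m, a ^ m x)` of `ℤ × B`. -/
def ctrlMul {B : Type*} [CommGroup B] (a : B) : GZ B ≃+ GZ B where
  toFun g := (g.1, g.1 • BReg.of a + g.2)
  invFun g := (g.1, -(g.1 • BReg.of a) + g.2)
  left_inv g := by simp
  right_inv g := by simp
  map_add' g h := by
    ext
    · rfl
    · simp only [Prod.fst_add, Prod.snd_add, add_zsmul]; abel

/-- The hybrid order-finding circuit: the Fourier transform over `𝕋`, the controlled multiplication
`c-V_a : |m, x⟩ ↦ |m, a ^ m x⟩` (one query), and the Fourier transform over `ℤ`. -/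
def shorCircuit {B : Type*} [CommGroup B] (a : B) : Circuit B .T .T :=
  .cons .qftT (.cons (.autoZ (ctrlMul a)) (.cons .qftZ .nil))

/-- The final state of the order-finding circuit on the approximate Fourier state of length
`2M+1`. -/
def shorOutput {B : Type*} [CommGroup B] [Finite B] (a : B) (M : ℕ) : HT B :=
  (shorCircuit a).run (approxZero B M)

/-! ## Continued-fraction post-processing -/

open Classical in
/-- The largest denominator, among those not exceeding `N`, of a convergent of the continued
fraction of `x`. -/
def cfDenom (N : ℕ) (x : ℝ) : ℕ :=
  Nat.findGreatest (fun s => ∃ j, (Real.convergent x j).den = s) N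

/-- The estimate of the order from the outcomes `ω₁, …, ω_t` of `t` measurements with resolution `d`:
the least common multiple of the continued-fraction denominators, bounded by `2 ^ n`, of
`ω_j / d`. -/
def cfOrder (n d : ℕ) {t : ℕ} (ω : Fin t → Fin d) : ℕ :=
  Finset.univ.lcm fun j => cfDenom (2 ^ n) (((ω j : ℕ) : ℝ) / d)

/-- The probability that `t` independent runs of the order-finding circuit for `a` (pulse length
`2M+1`, measurement resolution `d`), followed by the continued-fraction post-processing, yield the
order of `a`. -/
def successProb {B : Type*} [CommGroup B] [Finite B] (n M d t : ℕ) (a : B) : ℝ :=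
  ∑ ω : Fin t → Fin d,
    if cfOrder n d ω = orderOf a then ∏ j, outcomeProb (shorOutput a M) d (ω j) else 0

/-! ## Classical computation: random access machines with logarithmic (bit) cost -/

/-- Arithmetic instructions (truncated subtraction; quotient and remainder). -/
inductive Op : Type
  | add | sub | mul | div | mod

/-- The value of an arithmetic instruction. -/
def Op.eval : Op → ℕ → ℕ → ℕ
  | .add, u, v => u + v
  | .sub, u, v => u - v
  | .mul, u, v => u * v
  | .div, u, v => u / v
  | .mod, u, v => u % v

/-- A machine state: registers with fixed names, and a memory that is addressed indirectly. -/
structure Store : Type where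
  reg : ℕ → ℕ
  mem : ℕ → ℕ

/-- Assignment to a register. -/
def Store.setReg (σ : Store) (x v : ℕ) : Store := { σ with reg := Function.update σ.reg x v }

/-- Assignment to a memory cell. -/
def Store.setMem (σ : Store) (x v : ℕ) : Store := { σ with mem := Function.update σ.mem x v }

/-- The store with the given initial registers and memory cells, and zeros elsewhere. -/
def Store.init (regs mem : List ℕ) : Store := ⟨fun i => regs.getD i 0, fun i => mem.getD i 0⟩

/-- Programs. -/
inductive Prog : Type
  | skip : Prog
  | const (x v : ℕ) : Prog
  | op (o : Op) (x y z : ℕ) : Prog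
  | load (x y : ℕ) : Prog
  | store (x y : ℕ) : Prog
  | seq (P Q : Prog) : Prog
  | ite (x : ℕ) (P Q : Prog) : Prog
  | loop (x : ℕ) (P : Prog) : Prog

/-- `Exec P σ τ c`: started in `σ`, the program `P` halts in `τ`, at cost `c`. Every instruction costs
one plus the number of bits of all the numbers that it handles. -/
inductive Exec : Prog → Store → Store → ℕ → Prop
  | skip (σ : Store) : Exec .skip σ σ 1
  | const (σ : Store) (x v : ℕ) : Exec (.const x v) σ (σ.setReg x v) (1 + v.size)
  | op (σ : Store) (o : Op) (x y z : ℕ) :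
      Exec (.op o x y z) σ (σ.setReg x (o.eval (σ.reg y) (σ.reg z)))
        (1 + (σ.reg y).size + (σ.reg z).size + (o.eval (σ.reg y) (σ.reg z)).size)
  | load (σ : Store) (x y : ℕ) :
      Exec (.load x y) σ (σ.setReg x (σ.mem (σ.reg y)))
        (1 + (σ.reg y).size + (σ.mem (σ.reg y)).size)
  | store (σ : Store) (x y : ℕ) :
      Exec (.store x y) σ (σ.setMem (σ.reg x) (σ.reg y))
        (1 + (σ.reg x).size + (σ.reg y).size)
  | seq {P Q : Prog} {σ τ υ : Store} {c e : ℕ} (h₁ : Exec P σ τ c) (h₂ : Exec Q τ υ e) :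
      Exec (.seq P Q) σ υ (c + e)
  | ite_true {x : ℕ} {P Q : Prog} {σ τ : Store} {c : ℕ} (hx : σ.reg x ≠ 0) (h : Exec P σ τ c) :
      Exec (.ite x P Q) σ τ (1 + (σ.reg x).size + c)
  | ite_false {x : ℕ} {P Q : Prog} {σ τ : Store} {c : ℕ} (hx : σ.reg x = 0) (h : Exec Q σ τ c) :
      Exec (.ite x P Q) σ τ (1 + c)
  | loop_true {x : ℕ} {P : Prog} {σ τ υ : Store} {c e : ℕ} (hx : σ.reg x ≠ 0)
      (h₁ : Exec P σ τ c) (h₂ : Exec (.loop x P) τ υ e) :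
      Exec (.loop x P) σ υ (1 + (σ.reg x).size + c + e)
  | loop_false {x : ℕ} {P : Prog} {σ : Store} (hx : σ.reg x = 0) : Exec (.loop x P) σ σ 1

end BBN

end

/-!
The order-finding circuit maps the square pulse to
`(2M+1)^{-1/2} ∑_{|m| ≤ M} |m⟩ ⊗ |a ^ m⟩`, read in the basis labelled by `𝕋 × B`. The exponents `m` of
the pulse with `a ^ m = x` form an arithmetic progression whose difference is the order `r` of `a`,
so the outcome `(p, x)` has density `|D_L(r p)|² / (2M+1)`, where `D_L` is a Dirichlet kernel and `L` is the
number of these exponents (`exists_norm_amplitude_eq`, `measureT_shorOutput_prod`). The second part of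
the theorem follows from `|D_L(y)| ≥ 2L/π` for `‖y‖ ≤ 1/(2L)`: the resulting lower bound for the density
is multiplied by the measure `1/(L r)` of the ball around `k / r` (`le_measureT_shorOutput_closedBall`).

For the first part, put `d = 4 · 4^{n+k}`, `M = d³` and `t = 3 (n + k + 1)`. As `|D_L(y)| ≤ 1/(2‖y‖)`, an
outcome `p` is within `1/d` of some fraction `k / r`, except with a probability `ε` of order
`2^n d² / M`, which `M = d³` makes as small as `2^{-n-2k}`. The density is a function of `r p`, hence
invariant under translation by `1/r`. For a prime `p ∣ r` this translation takes the fractions whose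
numerator is divisible by `p` to fractions whose numerator is not, so the latter carry at least half
of the mass (`measureReal_nearFractions_not_dvd`); counting numerators is not necessary. If the
outcome is close to `k / r`, so is the centre `i / d` of its sector, and `k / r` is the last convergent of
`i / d` with denominator at most `2^n`: it is a convergent by Legendre's theorem, and a later one with a
small denominator would contradict the monotonicity of the errors `|den · x - num|`
(`cfDenom_eq_den`). So all `t` denominators divide `r` with probability at least `(1 - ε)^t`, and a given
prime power `p^e` that exactly divides `r` divides none of them with probability at most
`((1 + ε)/2)^t`. A union bound over the at most `n` prime factors of `r` gives the success probability
(`le_sum_prod_of_lcm_eq`, `le_successProb`).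

The programs are verified with a Hoare logic whose triples carry a cost bound and the invariant that
all numbers have at most `S` bits (`Runs`). One Euclidean loop serves twice: it computes the denominators
of the convergents, by `(q, q') ↦ (q ⌊a/b⌋ + q', q)` (`cfScan_eq_cfDenom`), and the greatest common
divisor in the least common multiple. It ends after at most `2 S` rounds since the product of the two
numbers at least halves in each round (`euclidProg_runs`).
-/

namespace BBN

/-! ### The Dirichlet kernel -/

/-- The (one-sided) Dirichlet kernel `∑_{j < L} e^{2πi j y}` on the circle. -/
noncomputable def dirichlet (L : ℕ) (y : UnitAddCircle) : ℂ :=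
  ∑ j ∈ Finset.range L, fourier (j : ℤ) y

lemma norm_fourier_one_sub_one (x : ℝ) :
    ‖(fourier 1 (x : UnitAddCircle) : ℂ) - 1‖ = 2 * |Real.sin (Real.pi * x)| := by
  have := Complex.norm_exp_I_mul_ofReal_sub_one (2 * Real.pi * x)
  rw [fourier_coe_apply]
  have e : (2 * Real.pi * Complex.I * ((1 : ℤ) : ℂ) * x / ((1 : ℝ) : ℂ)) =
      Complex.I * ((2 * Real.pi * x : ℝ) : ℂ) := by push_cast; ring
  rw [e, this, Real.norm_eq_abs, abs_mul, abs_two]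
  congr 3; ring

/-- The geometric sum formula, in absolute values and without a division. -/
lemma norm_dirichlet_mul (L : ℕ) (x : ℝ) :
    ‖dirichlet L (x : UnitAddCircle)‖ * |Real.sin (Real.pi * x)| =
      |Real.sin (Real.pi * (L * x))| := by
  have h1 : ∀ j : ℕ, (fourier (j : ℤ) (x : UnitAddCircle) : ℂ) =
      (fourier 1 (x : UnitAddCircle) : ℂ) ^ j := by
    intro j
    simp only [fourier_apply, natCast_zsmul, one_zsmul]
    rw [AddCircle.toCircle_nsmul, Circle.coe_pow]
  have h2 := geom_sum_mul (fourier 1 (x : UnitAddCircle) : ℂ) L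
  have h3 : (fourier 1 (x : UnitAddCircle) : ℂ) ^ L =
      fourier 1 (((L * x : ℝ)) : UnitAddCircle) := by
    rw [← h1, fourier_coe_apply, fourier_coe_apply]; push_cast; ring_nf
  simp_rw [← h1] at h2
  have h4 := congrArg norm h2
  rw [h1, h3, norm_mul, norm_fourier_one_sub_one, norm_fourier_one_sub_one] at h4
  unfold dirichlet
  linarith

lemma two_mul_abs_le_abs_sin {x : ℝ} (hx : |x| ≤ 1 / 2) : 2 * |x| ≤ |Real.sin (Real.pi * x)| := by
  have h := Real.mul_le_sin (x := Real.pi * |x|) (by positivity) (by nlinarith [Real.pi_pos])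
  have e : Real.sin (Real.pi * |x|) ≤ |Real.sin (Real.pi * x)| := by
    rcases abs_cases x with ⟨h, _⟩ | ⟨h, _⟩ <;> rw [h]
    · exact le_abs_self _
    · rw [mul_neg, Real.sin_neg]; exact neg_le_abs _
  refine le_trans (le_of_eq ?_) (h.trans e)
  field_simp

lemma le_norm_dirichlet {L : ℕ} {x : ℝ} (hx : L * |x| ≤ 1 / 2) :
    2 * L / Real.pi ≤ ‖dirichlet L (x : UnitAddCircle)‖ := by
  rcases eq_or_ne x 0 with rfl | h0
  · have : dirichlet L ((0 : ℝ) : UnitAddCircle) = L := by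
      simp [dirichlet]
    rw [this, Complex.norm_natCast, div_le_iff₀ Real.pi_pos]
    nlinarith [Real.pi_gt_three, (Nat.cast_nonneg L : (0 : ℝ) ≤ L)]
  · have h1 := norm_dirichlet_mul L x
    have h2 := two_mul_abs_le_abs_sin (x := L * x) (by rwa [abs_mul, Nat.abs_cast])
    have h3 : |Real.sin (Real.pi * x)| ≤ Real.pi * |x| := by
      simpa [abs_mul, abs_of_pos Real.pi_pos] using Real.abs_sin_le_abs (x := Real.pi * x)
    rw [abs_mul, Nat.abs_cast] at h2
    have hx0 : 0 < |x| := abs_pos.mpr h0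
    rw [div_le_iff₀ Real.pi_pos]
    have h4 := mul_le_mul_of_nonneg_left h3 (norm_nonneg (dirichlet L (x : UnitAddCircle)))
    refine le_of_mul_le_mul_right ?_ hx0
    linarith

/-- The representative of a point of the circle of least absolute value. -/
lemma exists_rep (y : UnitAddCircle) : ∃ x : ℝ, (x : UnitAddCircle) = y ∧ |x| = ‖y‖ := by
  induction y using QuotientAddGroup.induction_on with
  | H z =>
    refine ⟨z - round z, ?_, ?_⟩
    · have : ((round z : ℝ) : UnitAddCircle) = 0 := by
        rw [AddCircle.coe_eq_zero_iff]; exact ⟨round z, by simp⟩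
      rw [AddCircle.coe_sub, this, sub_zero]
    · exact (UnitAddCircle.norm_eq).symm

lemma norm_dirichlet_le (L : ℕ) (y : UnitAddCircle) : ‖dirichlet L y‖ * (2 * ‖y‖) ≤ 1 := by
  obtain ⟨x, rfl, hx⟩ := exists_rep y
  have hx2 : |x| ≤ 1 / 2 := by
    have := AddCircle.norm_le_half_period (1 : ℝ) (x := (x : UnitAddCircle)) one_ne_zero
    rw [hx]; simpa using this
  rw [← hx]
  calc _ ≤ ‖dirichlet L (x : UnitAddCircle)‖ * |Real.sin (Real.pi * x)| :=
        mul_le_mul_of_nonneg_left (two_mul_abs_le_abs_sin hx2) (norm_nonneg _)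
    _ = |Real.sin (Real.pi * (L * x))| := norm_dirichlet_mul L x
    _ ≤ 1 := Real.abs_sin_le_one _

lemma continuous_dirichlet (L : ℕ) : Continuous (dirichlet L) := by
  unfold dirichlet
  exact continuous_finsetSum _ fun j _ => map_continuous _

lemma norm_sum_fourier_progression (m₀ : ℤ) (r L : ℕ) (y : UnitAddCircle) :
    ‖∑ j ∈ Finset.range L, (fourier (m₀ + r * (j : ℤ)) y : ℂ)‖ = ‖dirichlet L (r • y)‖ := by
  have : ∀ j : ℕ, (fourier (m₀ + r * (j : ℤ)) y : ℂ) = fourier m₀ y * fourier (j : ℤ) (r • y) := by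
    intro j
    rw [fourier_add]
    congr 1
    rw [fourier_apply, fourier_apply, mul_comm, mul_zsmul, natCast_zsmul _ r]
  simp_rw [this]
  rw [← Finset.mul_sum, norm_mul, fourier_apply, Circle.norm_coe, one_mul, dirichlet]

/-! ### The final state of the order-finding circuit -/

section output
variable {B : Type*} [CommGroup B] [Finite B]

lemma shorOutput_eq_sum (a : B) (M : ℕ) :
    shorOutput a M = ((1 / Real.sqrt (2 * M + 1) : ℝ) : ℂ) •
      ∑ m ∈ Finset.Icc (-(M : ℤ)) M, charVec ((m, BReg.of (a ^ m)) : GZ B) := by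
  classical
  have h1 : shorOutput a M = (fourierB B).repr.symm
      (⟨fun g => (pulse B M) ((ctrlMul a).symm g), memlp_comp (ctrlMul a) (pulse B M)⟩ : HZ B) := by
    have : (fourierB B).repr (approxZero B M) = pulse B M := by
      rw [approxZero, LinearIsometryEquiv.apply_symm_apply]
    rw [← this]
    rfl
  have h2 : (⟨fun g => (pulse B M) ((ctrlMul a).symm g), memlp_comp (ctrlMul a) (pulse B M)⟩ : HZ B)
      = ((1 / Real.sqrt (2 * M + 1) : ℝ) : ℂ) •
        ∑ m ∈ Finset.Icc (-(M : ℤ)) M,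
          lp.single 2 ((m, BReg.of (a ^ m)) : GZ B) (1 : ℂ) := by
    ext g
    simp only [pulse, lp.coeFn_smul, lp.coeFn_sum, Pi.smul_apply, Finset.sum_apply,
      lp.single_apply]
    congr 1
    refine Finset.sum_congr rfl fun m _ => ?_
    simp only [Pi.single_apply]
    have : ((ctrlMul a).symm g = ((m, BReg.of 1) : GZ B)) ↔ g = ((m, BReg.of (a ^ m)) : GZ B) := by
      rw [AddEquiv.symm_apply_eq]
      have : ctrlMul a ((m, BReg.of 1) : GZ B) = ((m, BReg.of (a ^ m)) : GZ B) := by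
        change ((m, m • BReg.of a + BReg.of 1) : GZ B) = _
        congr 1
        change BReg.of (a ^ m * 1) = _
        rw [mul_one]
      rw [this]
    simp only [this]
  rw [h1, h2, map_smul, map_sum]
  congr 1
  refine Finset.sum_congr rfl fun m _ => ?_
  rw [HilbertBasis.repr_symm_single]
  simp [fourierB]

/-- The controlled multiplication by `1` is trivial, so the initial state is the output of the
circuit for `a = 1`. -/
lemma approxZero_eq_shorOutput (M : ℕ) : approxZero B M = shorOutput (1 : B) M := by
  classical
  rw [shorOutput_eq_sum, approxZero, pulse, map_smul, map_sum]
  congr 1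
  refine Finset.sum_congr rfl fun m _ => ?_
  rw [HilbertBasis.repr_symm_single]
  simp [fourierB]

open Classical in
/-- The wavefunction of the final state, up to its normalisation. -/
noncomputable def amplitude (a : B) (M : ℕ) (g : GT B) : ℂ :=
  ∑ m ∈ (Finset.Icc (-(M : ℤ)) M).filter (fun m => BReg.of (a ^ m) = g.2), fourier m g.1

omit [Finite B] in
lemma amplitude_eq_sum_charFun (a : B) (M : ℕ) (g : GT B) :
    amplitude a M g = ∑ m ∈ Finset.Icc (-(M : ℤ)) M, charFun B (m, BReg.of (a ^ m)) g := by
  classical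
  rw [amplitude, Finset.sum_filter]
  refine Finset.sum_congr rfl fun m _ => ?_
  simp only [charFun, eq_comm]

lemma shorOutput_ae_eq (a : B) (M : ℕ) :
    shorOutput a M =ᵐ[haarT B]
      fun g => ((1 / Real.sqrt (2 * M + 1) : ℝ) : ℂ) * amplitude a M g := by
  rw [shorOutput_eq_sum]
  have h0 : ∀ m : ℤ, ((charVec ((m, BReg.of (a ^ m)) : GZ B) : HT B) : GT B → ℂ) =ᵐ[haarT B]
      charFun B (m, BReg.of (a ^ m)) := fun m => (charFun_memLp _).coeFn_toLp
  have h1 : ∀ s : Finset ℤ, (((∑ m ∈ s, charVec ((m, BReg.of (a ^ m)) : GZ B)) : HT B) :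
      GT B → ℂ) =ᵐ[haarT B] fun g => ∑ m ∈ s, charFun B (m, BReg.of (a ^ m)) g := by
    intro s
    filter_upwards [Lp.coeFn_finsetSum s (fun m => charVec ((m, BReg.of (a ^ m)) : GZ B)),
      (ae_all_iff.mpr h0)] with g hg hg0
    rw [hg, Finset.sum_apply]
    exact Finset.sum_congr rfl fun m _ => hg0 m
  filter_upwards [Lp.coeFn_smul ((1 / Real.sqrt (2 * M + 1) : ℝ) : ℂ)
    (∑ m ∈ Finset.Icc (-(M : ℤ)) M, charVec ((m, BReg.of (a ^ m)) : GZ B)),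
    h1 (Finset.Icc (-(M : ℤ)) M)] with g hg hg1
  rw [hg, Pi.smul_apply, hg1, amplitude_eq_sum_charFun, smul_eq_mul]

/-- The measurement at the end of the order-finding circuit yields an outcome in `A × {b}` with
probability given by the integral of the squared amplitude. -/
lemma measureT_shorOutput_prod (a : B) (M : ℕ) (A : Set UnitAddCircle) (hA : MeasurableSet A)
    (b : BReg B) :
    measureT (shorOutput a M) (A ×ˢ {b}) =
      ∫⁻ t in A, ENNReal.ofReal (‖amplitude a M (t, b)‖ ^ 2 / (2 * M + 1))
        ∂(AddCircle.haarAddCircle (T := (1 : ℝ))) := by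
  have hAb : MeasurableSet (A ×ˢ ({b} : Set (BReg B))) := hA.prod (MeasurableSet.of_discrete)
  have hm : Measurable fun g : GT B => ENNReal.ofReal (‖amplitude a M g‖ ^ 2 / (2 * M + 1)) := by
    simp_rw [amplitude_eq_sum_charFun]
    have : ∀ g : GZ B, Measurable (charFun B g) := fun g => by
      classical
      unfold charFun
      refine Measurable.ite ?_ ?_ measurable_const
      · exact measurable_snd (MeasurableSet.of_discrete (s := {g.2}))
      · exact (map_continuous (fourier g.1)).measurable.comp measurable_fst
    fun_prop
  have h1 : (fun g => ‖shorOutput a M g‖ₑ ^ 2) =ᵐ[haarT B]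
      fun g => ENNReal.ofReal (‖amplitude a M g‖ ^ 2 / (2 * M + 1)) := by
    filter_upwards [shorOutput_ae_eq a M] with g hg
    rw [hg, ← ofReal_norm, ← ENNReal.ofReal_pow (norm_nonneg _), norm_mul, mul_pow,
      Complex.norm_real, Real.norm_eq_abs, sq_abs, div_pow, one_pow, Real.sq_sqrt (by positivity)]
    congr 1
    ring
  rw [measureT, withDensity_congr_ae h1, withDensity_apply _ hAb, haarT, ← Measure.prod_restrict,
    Measure.restrict_singleton, Measure.count_singleton, one_smul, Measure.prod_dirac,
    lintegral_map hm (by fun_prop)]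

omit [CommGroup B] [Finite B] in
lemma measureT_univ (ψ : HT B) : measureT ψ Set.univ = ENNReal.ofReal (‖ψ‖ ^ 2) := by
  rw [measureT, withDensity_apply _ MeasurableSet.univ, setLIntegral_univ]
  have h := Lp.norm_def ψ
  rw [eLpNorm_eq_lintegral_rpow_enorm_toReal two_ne_zero ENNReal.ofNat_ne_top] at h
  have h2 : ∫⁻ x, ‖ψ x‖ₑ ^ (2 : ℝ) ∂(haarT B) ≠ ∞ := by
    have := (lintegral_rpow_enorm_lt_top_of_eLpNorm_lt_top two_ne_zero ENNReal.ofNat_ne_top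
      (Lp.memLp ψ).2).ne
    simpa using this
  simp only [ENNReal.toReal_ofNat, ENNReal.rpow_ofNat] at h h2
  rw [h, ← ENNReal.toReal_rpow, ← Real.rpow_natCast, ← Real.rpow_mul ENNReal.toReal_nonneg]
  norm_num
  rw [ENNReal.ofReal_toReal h2]

lemma norm_shorOutput (a : B) (M : ℕ) : ‖shorOutput a M‖ = 1 := by
  have ho : Orthonormal ℂ fun m : ℤ => charVec ((m, BReg.of (a ^ m)) : GZ B) :=
    (orthonormal_charVec B).comp _ fun m m' h => (Prod.ext_iff.mp h).1
  have h := ho.inner_sum (fun _ => 1) (fun _ => 1) (Finset.Icc (-(M : ℤ)) M)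
  simp only [one_smul, map_one, Finset.sum_const, Int.card_Icc, nsmul_eq_mul, mul_one,
    inner_self_eq_norm_sq_to_K] at h
  have hc : ((M : ℤ) + 1 - -(M : ℤ)).toNat = 2 * M + 1 := by omega
  rw [hc] at h
  have h' : ‖∑ m ∈ Finset.Icc (-(M : ℤ)) M, charVec ((m, BReg.of (a ^ m)) : GZ B)‖ ^ 2
      = 2 * M + 1 := by
    apply Complex.ofReal_injective
    push_cast at h ⊢
    exact h
  rw [shorOutput_eq_sum, norm_smul, Complex.norm_real, Real.norm_eq_abs, abs_of_nonneg (by positivity),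
    ← Real.sqrt_sq (norm_nonneg (∑ m ∈ _, _)), h']
  field_simp

instance (a : B) (M : ℕ) : IsProbabilityMeasure (measureT (shorOutput a M)) :=
  ⟨by rw [measureT_univ, norm_shorOutput]; simp⟩

/-- The exponents `m`, `|m| ≤ M`, with `a ^ m = x` form an arithmetic progression. -/
lemma exists_progression (a x : B) (M : ℕ) : ∃ (m₀ : ℤ) (L : ℕ), ∀ m : ℤ,
    (|m| ≤ M ∧ a ^ m = x) ↔ ∃ j < L, m = m₀ + orderOf a * (j : ℤ) := by
  by_cases hx : ∃ m : ℤ, |m| ≤ M ∧ a ^ m = x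
  · obtain ⟨m₁, hm₁, rfl⟩ := hx
    have hr : (0 : ℤ) < orderOf a := by exact_mod_cast orderOf_pos a
    set r : ℤ := (orderOf a : ℤ)
    -- the least exponent in the window, and the number of steps of length `r` up to `M`
    refine ⟨-M + (m₁ + M) % r, ((M - (-M + (m₁ + M) % r)) / r + 1).toNat, fun m => ?_⟩
    set s := (m₁ + M) % r with hs
    have hs0 : 0 ≤ s := Int.emod_nonneg _ hr.ne'
    have hsr : s < r := Int.emod_lt_of_pos _ hr
    have hsd : r ∣ m₁ + M - s := Int.dvd_self_sub_emod
    rw [abs_le] at hm₁ ⊢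
    have hsm : s ≤ m₁ + M := by
      have h1 := Int.mul_ediv_add_emod (m₁ + M) r
      have h2 : 0 ≤ (m₁ + M) / r := Int.ediv_nonneg (by linarith [hm₁.1]) hr.le
      nlinarith
    rw [← orderOf_dvd_sub_iff_zpow_eq_zpow]
    constructor
    · rintro ⟨⟨h1, h2⟩, h3⟩
      have h4 : r ∣ m - (-M + s) := by
        have e : m - (-M + s) = (m - m₁) + (m₁ + M - s) := by ring
        rw [e]
        exact dvd_add h3 hsd
      obtain ⟨j, hj⟩ := h4
      have hj0 : 0 ≤ j := by
        by_contra hneg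
        have : r * j ≤ r * (-1) := mul_le_mul_of_nonneg_left (by omega) hr.le
        linarith
      refine ⟨j.toNat, ?_, ?_⟩
      · have : j ≤ (M - (-M + s)) / r := by
          rw [Int.le_ediv_iff_mul_le hr]; linarith
        omega
      · rw [Int.toNat_of_nonneg hj0]; linarith
    · rintro ⟨j, hj, rfl⟩
      have h1 : (j : ℤ) ≤ (M - (-M + s)) / r := by
        have : (0 : ℤ) ≤ (M - (-M + s)) / r := Int.ediv_nonneg (by linarith [hm₁.2]) hr.le
        omega
      rw [Int.le_ediv_iff_mul_le hr] at h1
      refine ⟨⟨by nlinarith, by linarith⟩, ?_⟩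
      have : -↑M + s + r * ↑j - m₁ = r * j - (m₁ + M - s) := by ring
      rw [this]
      exact dvd_sub (dvd_mul_right _ _) hsd
  · push Not at hx
    refine ⟨0, 0, fun m => ?_⟩
    simp only [not_lt_zero, false_and, exists_false, iff_false, not_and]
    exact hx m

/-- The squared amplitude of the outcome `(t, x)` is a Dirichlet kernel, evaluated at `r t` for
the order `r` of `a`; its length is the number of exponents `m` in the pulse with `a ^ m = x`. -/
lemma exists_norm_amplitude_eq (a x : B) (M : ℕ) : ∃ L : ℕ,
    {m : ℤ | |m| ≤ M ∧ a ^ m = x}.ncard = L ∧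
    ∀ t, ‖amplitude a M (t, BReg.of x)‖ = ‖dirichlet L (orderOf a • t)‖ := by
  classical
  obtain ⟨m₀, L, h⟩ := exists_progression a x M
  have hr : (orderOf a : ℤ) ≠ 0 := by exact_mod_cast (orderOf_pos a).ne'
  have hinj : Function.Injective fun j : ℕ => m₀ + orderOf a * (j : ℤ) := by
    intro i j hij
    exact_mod_cast mul_left_cancel₀ hr (add_left_cancel hij)
  refine ⟨L, ?_, fun t => ?_⟩
  · have : {m : ℤ | |m| ≤ M ∧ a ^ m = x} =
        ((Finset.range L).image fun j : ℕ => m₀ + orderOf a * (j : ℤ) : Finset ℤ) := by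
      ext m
      rw [Set.mem_ofPred_eq, h]
      simp only [Finset.coe_image, Finset.coe_range, Set.mem_image, Set.mem_Iio, eq_comm]
    rw [this, Set.ncard_coe_finset, Finset.card_image_of_injective _ hinj, Finset.card_range]
  · rw [← norm_sum_fourier_progression m₀, amplitude]
    congr 1
    rw [← Finset.sum_image (s := Finset.range L) (g := fun j : ℕ => m₀ + orderOf a * (j : ℤ))
      (f := fun m => (fourier m t : ℂ)) (fun _ _ _ _ e => hinj e)]
    refine Finset.sum_congr ?_ fun _ _ => rfl
    ext m
    have h2 : BReg.of (a ^ m) = BReg.of x ↔ a ^ m = x := Iff.rfl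
    rw [Finset.mem_filter, Finset.mem_Icc, ← abs_le, h2, h]
    simp only [Finset.mem_image, Finset.mem_range, eq_comm]

end output

/-! ### The distribution of the outcome -/

lemma haarAddCircle_eq_volume : (AddCircle.haarAddCircle (T := (1 : ℝ))) = volume := by
  rw [AddCircle.volume_eq_smul_haarAddCircle]; simp

lemma nsmul_intCast_div {r : ℕ} (hr : 0 < r) (k : ℤ) :
    r • (((k : ℝ) / r : ℝ) : UnitAddCircle) = 0 := by
  rw [← AddCircle.coe_nsmul, AddCircle.coe_eq_zero_iff]
  refine ⟨k, ?_⟩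
  have : (r : ℝ) ≠ 0 := by positivity
  simp; field_simp

section output
variable {B : Type*} [CommGroup B] [Finite B]

/-- Near `k / r` the Dirichlet kernel of length `L` exceeds `(2L/π)²` throughout a closed ball of
measure `1 / (L r)`. -/
lemma le_measureT_shorOutput_closedBall (a x : B) (M L : ℕ) (k : ℤ)
    (hL : L = {m : ℤ | |m| ≤ M ∧ a ^ m = x}.ncard) :
    (L : ℝ) / (2 * M + 1) * (4 / (Real.pi ^ 2 * orderOf a)) ≤
      (measureT (shorOutput a M)).real {g | g.2 = BReg.of x ∧
        ‖g.1 - (((k : ℝ) / orderOf a : ℝ) : UnitAddCircle)‖ ≤ 1 / (2 * L * orderOf a)} := by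
  rcases Nat.eq_zero_or_pos L with h0 | hLpos
  · rw [h0]; simp
  obtain ⟨L', hL', hamp⟩ := exists_norm_amplitude_eq a x M
  obtain rfl : L = L' := hL.trans hL'
  have hr := orderOf_pos a
  set r := orderOf a
  set y : UnitAddCircle := (((k : ℝ) / r : ℝ) : UnitAddCircle)
  set ρ : ℝ := 1 / (2 * L * r) with hρ
  have hset : {g : GT B | g.2 = BReg.of x ∧ ‖g.1 - y‖ ≤ ρ} =
      Metric.closedBall y ρ ×ˢ {BReg.of x} := by
    ext g; simp [dist_eq_norm, and_comm]
  have hLr : (1 : ℝ) ≤ L * r := by exact_mod_cast Nat.mul_pos hLpos hr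
  have hvol : (AddCircle.haarAddCircle (T := (1 : ℝ))) (Metric.closedBall y ρ) =
      ENNReal.ofReal (1 / (L * r)) := by
    rw [haarAddCircle_eq_volume, AddCircle.volume_closedBall]
    congr 1
    have e : 2 * ρ = 1 / (L * r) := by rw [hρ]; field_simp
    rw [e]
    exact min_eq_right (by rw [div_le_one (by linarith)]; exact hLr)
  have hlow : ∀ t ∈ Metric.closedBall y ρ, ENNReal.ofReal ((2 * L / Real.pi) ^ 2 / (2 * M + 1)) ≤
      ENNReal.ofReal (‖amplitude a M (t, BReg.of x)‖ ^ 2 / (2 * M + 1)) := by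
    intro t ht
    rw [mem_closedBall_iff_norm] at ht
    obtain ⟨u, hu, hun⟩ := exists_rep (t - y)
    have hrt : r • t = ((r * u : ℝ) : UnitAddCircle) := by
      have : t = y + (u : UnitAddCircle) := by rw [hu]; abel
      rw [this, nsmul_add, nsmul_intCast_div hr, zero_add, ← AddCircle.coe_nsmul, nsmul_eq_mul]
    have hb : L * |(r * u : ℝ)| ≤ 1 / 2 := by
      rw [abs_mul, Nat.abs_cast, hun]
      calc (L : ℝ) * (r * ‖t - y‖) ≤ L * (r * ρ) := by gcongr
        _ = 1 / 2 := by rw [hρ]; field_simp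
    rw [hamp, hrt]
    have := le_norm_dirichlet hb
    gcongr
  rw [hset, measureReal_def]
  refine (ENNReal.ofReal_le_iff_le_toReal (measure_ne_top _ _)).mp ?_
  rw [measureT_shorOutput_prod a M _ measurableSet_closedBall]
  refine le_trans (le_of_eq ?_) (setLIntegral_mono_ae' measurableSet_closedBall
    (Filter.Eventually.of_forall hlow))
  rw [setLIntegral_const, hvol, ← ENNReal.ofReal_mul (by positivity)]
  congr 1
  have := Real.pi_pos
  field_simp
  norm_num

/-- The distribution of the `𝕋`-component of the outcome has a density of the form `f (r t)`, where
`r` is the order of `a`; away from `0`, `f` is at most of order `1 / M`. -/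
lemma exists_density (a : B) (M : ℕ) : ∃ f : UnitAddCircle → ℝ≥0∞, Measurable f ∧
    (measureT (shorOutput a M)).fst =
      (AddCircle.haarAddCircle (T := (1 : ℝ))).withDensity (fun t => f (orderOf a • t)) ∧
    ∀ (η : ℝ) (y : UnitAddCircle), 0 < η → η ≤ ‖y‖ →
      f y ≤ ENNReal.ofReal (Nat.card B / (4 * η ^ 2 * (2 * M + 1))) := by
  have := Fintype.ofFinite (BReg B)
  choose! L hL hamp using fun x : B => exists_norm_amplitude_eq a x M
  let Lb : BReg B → ℕ := fun b => L (Additive.toMul b)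
  have hampb : ∀ (b : BReg B) t, ‖amplitude a M (t, b)‖ = ‖dirichlet (Lb b) (orderOf a • t)‖ :=
    fun b t => hamp (Additive.toMul b) t
  have hmeas : ∀ L, Measurable fun y => ENNReal.ofReal (‖dirichlet L y‖ ^ 2 / (2 * M + 1)) := by
    intro L
    have := (continuous_dirichlet L).measurable
    fun_prop
  refine ⟨fun y => ∑ b, ENNReal.ofReal (‖dirichlet (Lb b) y‖ ^ 2 / (2 * M + 1)),
    by fun_prop, ?_, ?_⟩
  · ext A hA
    rw [Measure.fst_apply hA, withDensity_apply _ hA, lintegral_finsetSum]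
    · have hU : Prod.fst ⁻¹' A = ⋃ b ∈ (Finset.univ : Finset (BReg B)), (A ×ˢ {b} : Set (GT B)) := by
        ext g; simp
      rw [hU, measure_biUnion_finset]
      · refine Finset.sum_congr rfl fun b _ => ?_
        rw [measureT_shorOutput_prod a M A hA]
        simp_rw [hampb]
      · intro b _ c _ hbc
        refine Set.disjoint_left.mpr fun g hg hg' => hbc ?_
        exact hg.2.symm.trans hg'.2
      · exact fun b _ => hA.prod MeasurableSet.of_discrete
    · intro b _
      exact (hmeas _).comp (by fun_prop)
  · intro η y hη hy
    have h1 : ∀ b ∈ (Finset.univ : Finset (BReg B)),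
        ENNReal.ofReal (‖dirichlet (Lb b) y‖ ^ 2 / (2 * M + 1)) ≤
          ENNReal.ofReal (1 / (4 * η ^ 2 * (2 * M + 1))) := by
      intro b _
      refine ENNReal.ofReal_le_ofReal ?_
      have h2 := norm_dirichlet_le (Lb b) y
      have h3 : ‖dirichlet (Lb b) y‖ * (2 * η) ≤ 1 :=
        le_trans (by gcongr) h2
      have h4 : ‖dirichlet (Lb b) y‖ ^ 2 * (4 * η ^ 2) ≤ 1 := by
        have := pow_le_one₀ (n := 2) (by positivity) h3
        linarith [this, mul_pow (‖dirichlet (Lb b) y‖) (2 * η) 2, mul_pow 2 η 2]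
      rw [div_le_div_iff₀ (by positivity) (by positivity)]
      have : (0 : ℝ) < 2 * M + 1 := by positivity
      nlinarith
    refine (Finset.sum_le_sum h1).trans (le_of_eq ?_)
    have hc : Finset.card (Finset.univ : Finset (BReg B)) = Nat.card B := by
      rw [Finset.card_univ, ← Nat.card_eq_fintype_card]; rfl
    rw [Finset.sum_const, hc, nsmul_eq_mul, ← ENNReal.ofReal_natCast,
      ← ENNReal.ofReal_mul (by positivity)]
    congr 1; ring

end output

/-! ### The marginal on the circle and its discretisation by sectors -/

/-- The points of the circle within `δ` of a fraction `k / r` whose numerator satisfies `Q`. -/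
def nearFractions (r : ℕ) (δ : ℝ) (Q : ℤ → Prop) : Set UnitAddCircle :=
  {t | ∃ k : ℤ, Q k ∧ ‖t - (((k : ℝ) / r : ℝ) : UnitAddCircle)‖ < δ}

lemma isOpen_nearFractions (r : ℕ) (δ : ℝ) (Q : ℤ → Prop) : IsOpen (nearFractions r δ Q) := by
  have : nearFractions r δ Q =
      ⋃ k : ℤ, ⋃ _ : Q k, Metric.ball (((k : ℝ) / r : ℝ) : UnitAddCircle) δ := by
    ext t; simp [nearFractions, dist_eq_norm]
  rw [this]
  exact isOpen_iUnion fun k => isOpen_iUnion fun _ => Metric.isOpen_ball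

lemma mem_nearFractions_of_norm_lt {r : ℕ} (hr : 0 < r) {δ : ℝ} {t : UnitAddCircle}
    (ht : ‖r • t‖ < r * δ) : t ∈ nearFractions r δ fun _ => True := by
  induction t using QuotientAddGroup.induction_on with
  | H z =>
    have hr' : (0 : ℝ) < r := by exact_mod_cast hr
    refine ⟨round (r * z), trivial, ?_⟩
    have h1 : r • ((z : ℝ) : UnitAddCircle) = ((r * z : ℝ) : UnitAddCircle) := by
      rw [← AddCircle.coe_nsmul, nsmul_eq_mul]
    have h2 : ‖r • ((z : ℝ) : UnitAddCircle)‖ < r * δ := ht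
    rw [h1, UnitAddCircle.norm_eq] at h2
    change ‖((z : ℝ) : UnitAddCircle) - _‖ < δ
    rw [← AddCircle.coe_sub]
    refine lt_of_le_of_lt (QuotientAddGroup.norm_mk_le_norm) ?_
    rw [Real.norm_eq_abs]
    have h3 : z - (round (r * z) : ℝ) / r = (r * z - round (r * z)) / r := by field_simp
    rw [h3, abs_div, abs_of_pos hr', div_lt_iff₀ hr']
    linarith

/-- A measure with density `f (r t)` is invariant under translation by `1 / r`. -/
lemma withDensity_nsmul_preimage_add {r : ℕ} (hr : 0 < r) (f : UnitAddCircle → ℝ≥0∞)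
    {A : Set UnitAddCircle} (hA : MeasurableSet A) :
    ((AddCircle.haarAddCircle (T := (1 : ℝ))).withDensity fun t => f (r • t))
        ((fun t => t + ((1 / r : ℝ) : UnitAddCircle)) ⁻¹' A) =
      ((AddCircle.haarAddCircle (T := (1 : ℝ))).withDensity fun t => f (r • t)) A := by
  set s : UnitAddCircle := ((1 / r : ℝ) : UnitAddCircle)
  have hs : r • s = 0 := by
    have h := nsmul_intCast_div hr 1
    rwa [Int.cast_one] at h
  have hA' : MeasurableSet ((fun t => t + s) ⁻¹' A) := hA.preimage (by fun_prop)
  rw [withDensity_apply _ hA, withDensity_apply _ hA']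
  have h := (measurePreserving_add_right (AddCircle.haarAddCircle (T := (1 : ℝ))) s
    ).setLIntegral_comp_preimage_emb (MeasurableEquiv.addRight s).measurableEmbedding
      (fun t => f (r • t)) A
  rw [← h]
  simp_rw [nsmul_add, hs, add_zero]

/-- Half of the mass near the fractions `k / r` lies near those whose numerator is not divisible by
a given `p > 1`: translation by `1 / r` maps the remaining ones to such fractions. -/
lemma measureReal_nearFractions_not_dvd {r : ℕ} (hr : 0 < r) (f : UnitAddCircle → ℝ≥0∞)
    (δ : ℝ) {p : ℕ} (hp : 1 < p)
    [IsProbabilityMeasure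
      ((AddCircle.haarAddCircle (T := (1 : ℝ))).withDensity fun t => f (r • t))] :
    ((AddCircle.haarAddCircle (T := (1 : ℝ))).withDensity fun t => f (r • t)).real
        (nearFractions r δ fun _ => True) ≤
      2 * ((AddCircle.haarAddCircle (T := (1 : ℝ))).withDensity fun t => f (r • t)).real
        (nearFractions r δ fun k => ¬ (p : ℤ) ∣ k) := by
  set ν := (AddCircle.haarAddCircle (T := (1 : ℝ))).withDensity fun t => f (r • t) with hν
  have h1 : nearFractions r δ (fun _ => True) ⊆
      nearFractions r δ (fun k => (p : ℤ) ∣ k) ∪ nearFractions r δ (fun k => ¬ (p : ℤ) ∣ k) := by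
    rintro t ⟨k, -, hk⟩
    by_cases h : (p : ℤ) ∣ k
    · exact Or.inl ⟨k, h, hk⟩
    · exact Or.inr ⟨k, h, hk⟩
  have h2 : nearFractions r δ (fun k => (p : ℤ) ∣ k) ⊆
      (fun t => t + ((1 / r : ℝ) : UnitAddCircle)) ⁻¹'
        nearFractions r δ (fun k => ¬ (p : ℤ) ∣ k) := by
    rintro t ⟨k, hk, hkt⟩
    refine ⟨k + 1, fun h => ?_, ?_⟩
    · have h3 : (p : ℤ) ∣ 1 := by simpa using dvd_sub h hk
      have := Int.le_of_dvd one_pos h3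
      omega
    · have e : (((k + 1 : ℤ) : ℝ) / r : ℝ) = (k : ℝ) / r + 1 / r := by push_cast; ring
      rw [e, AddCircle.coe_add, add_sub_add_right_eq_sub]
      exact hkt
  have h3 : ν.real (nearFractions r δ (fun k => (p : ℤ) ∣ k)) ≤
      ν.real (nearFractions r δ (fun k => ¬ (p : ℤ) ∣ k)) := by
    refine (measureReal_mono h2).trans (le_of_eq ?_)
    rw [measureReal_def, measureReal_def, hν,
      withDensity_nsmul_preimage_add hr f (isOpen_nearFractions _ _ _).measurableSet]
  have h4 := (measureReal_mono h1 (μ := ν)).trans (measureReal_union_le _ _)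
  linarith

lemma one_sub_le_measureReal_nearFractions {r : ℕ} (hr : 0 < r) (f : UnitAddCircle → ℝ≥0∞)
    {δ ε : ℝ} (hε : 0 ≤ ε) (hf : ∀ y, r * δ ≤ ‖y‖ → f y ≤ ENNReal.ofReal ε)
    [IsProbabilityMeasure
      ((AddCircle.haarAddCircle (T := (1 : ℝ))).withDensity fun t => f (r • t))] :
    1 - ε ≤ ((AddCircle.haarAddCircle (T := (1 : ℝ))).withDensity fun t => f (r • t)).real
      (nearFractions r δ fun _ => True) := by
  set ν := (AddCircle.haarAddCircle (T := (1 : ℝ))).withDensity fun t => f (r • t) with hν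
  have hE := (isOpen_nearFractions r δ fun _ => True).measurableSet
  have h1 : ν.real (nearFractions r δ fun _ => True)ᶜ ≤ ε := by
    rw [measureReal_def]
    refine ENNReal.toReal_le_of_le_ofReal hε ?_
    rw [hν, withDensity_apply _ hE.compl]
    calc _ ≤ ∫⁻ _ in (nearFractions r δ fun _ => True)ᶜ, ENNReal.ofReal ε
          ∂(AddCircle.haarAddCircle (T := (1 : ℝ))) := by
          refine setLIntegral_mono_ae' hE.compl (Filter.Eventually.of_forall fun t ht => hf _ ?_)
          by_contra h
          exact ht (mem_nearFractions_of_norm_lt hr (not_le.mp h))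
      _ ≤ ENNReal.ofReal ε := by
          rw [setLIntegral_const]
          exact mul_le_of_le_one_right' prob_le_one
  have := probReal_compl_eq_one_sub (μ := ν) hE
  linarith

lemma isOpen_sector (d i : ℕ) : IsOpen (sector d i) := by
  unfold sector
  exact isOpen_lt (by fun_prop) continuous_const

/-- Reduction of a circle inequality to the reals, at the cost of changing the numerator by a
multiple of the denominator. -/
lemma exists_int_abs_sub_lt {r : ℕ} (hr : 0 < r) {x η : ℝ} {k : ℤ}
    (h : ‖(x : UnitAddCircle) - (((k : ℝ) / r : ℝ) : UnitAddCircle)‖ < η) :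
    ∃ m : ℤ, |x - ((k + r * m : ℤ) : ℝ) / r| < η := by
  rw [← AddCircle.coe_sub, UnitAddCircle.norm_eq] at h
  refine ⟨round (x - (k : ℝ) / r), ?_⟩
  have hr' : (r : ℝ) ≠ 0 := by positivity
  convert h using 2
  push_cast
  field_simp
  ring

lemma sector_disjoint {d i j : ℕ} (hi : i < d) (hj : j < d) (hij : i ≠ j) :
    Disjoint (sector d i) (sector d j) := by
  refine Set.disjoint_left.mpr fun t hti htj => hij ?_
  have hd : 0 < d := by omega
  have hd' : (0 : ℝ) < d := by exact_mod_cast hd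
  have h : ‖(((i : ℝ) / d : ℝ) : UnitAddCircle) - ((((j : ℤ) : ℝ) / d : ℝ) : UnitAddCircle)‖
      < 1 / d := by
    have h1 : ‖t - _‖ < _ := hti
    have h2 : ‖t - _‖ < _ := htj
    rw [norm_sub_rev] at h1
    have e : (((i : ℝ) / d : ℝ) : UnitAddCircle) - ((((j : ℤ) : ℝ) / d : ℝ) : UnitAddCircle) =
      ((((i : ℝ) / d : ℝ) : UnitAddCircle) - t) + (t - (((j : ℝ) / d : ℝ) : UnitAddCircle)) := by
      push_cast; abel
    rw [e]
    refine (norm_add_le _ _).trans_lt ((add_lt_add h1 h2).trans_eq ?_)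
    field_simp; norm_num
  obtain ⟨m, hm⟩ := exists_int_abs_sub_lt hd h
  rw [← sub_div, abs_div, abs_of_pos hd', div_lt_div_iff_of_pos_right hd'] at hm
  have h3 : |(i : ℤ) - (j + d * m)| < 1 := by exact_mod_cast hm
  have h4 : (i : ℤ) = j + d * m := by
    have := Int.abs_lt_one_iff.mp h3; linarith
  have h5 : i % d = j % d := by
    have : (i : ℤ) % d = j % d := by rw [h4]; simp
    exact_mod_cast this
  rwa [Nat.mod_eq_of_lt hi, Nat.mod_eq_of_lt hj] at h5

/-- The points outside all sectors are the midpoints between neighbouring `i / d`: a null set. -/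
lemma volume_compl_iUnion_sector {d : ℕ} (hd : 0 < d) :
    (AddCircle.haarAddCircle (T := (1 : ℝ))) {t | ∀ i < d, t ∉ sector d i} = 0 := by
  have hd' : (0 : ℝ) < d := by exact_mod_cast hd
  have hsub : {t : UnitAddCircle | ∀ i < d, t ∉ sector d i} ⊆
      Set.range fun l : ℤ => (((l + 1 / 2) / d : ℝ) : UnitAddCircle) := by
    intro t ht
    induction t using QuotientAddGroup.induction_on with
    | H z =>
      -- `z` lies in the sector of the nearest `l / d`, or at distance exactly `1 / (2d)` from it
      set l := round (d * z) with hl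
      have hround : |d * z - l| ≤ 1 / 2 := abs_sub_round _
      by_cases hlt : |d * z - l| < 1 / 2
      · exfalso
        have hmod : 0 ≤ l % d := Int.emod_nonneg _ (by omega)
        have hmod' : l % d < d := Int.emod_lt_of_pos _ (by omega)
        refine ht (l % d).toNat (by omega) ?_
        change ‖((z : ℝ) : UnitAddCircle) - _‖ < _
        have e1 : (((l % d).toNat : ℕ) : ℝ) = ((l % d : ℤ) : ℝ) := by
          exact_mod_cast congrArg (Int.cast (R := ℝ)) (Int.toNat_of_nonneg hmod)
        have e2 : ((((l % d).toNat : ℕ) : ℝ) / d : ℝ) = (l : ℝ) / d - ((l / d : ℤ) : ℝ) := by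
          rw [e1, Int.emod_def]; push_cast; field_simp
        have e3 : (((((l % d).toNat : ℕ) : ℝ) / d : ℝ) : UnitAddCircle) =
            (((l : ℝ) / d : ℝ) : UnitAddCircle) := by
          rw [e2, AddCircle.coe_sub, sub_eq_self, AddCircle.coe_eq_zero_iff]
          exact ⟨l / d, by simp⟩
        rw [e3, ← AddCircle.coe_sub]
        refine lt_of_le_of_lt (QuotientAddGroup.norm_mk_le_norm) ?_
        rw [Real.norm_eq_abs]
        have e4 : z - (l : ℝ) / d = (d * z - l) / d := by field_simp
        rw [e4, abs_div, abs_of_pos hd', div_lt_div_iff₀ hd' (by positivity)]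
        nlinarith
      · have heq : |d * z - l| = 1 / 2 := le_antisymm hround (not_lt.mp hlt)
        rcases (abs_eq (by norm_num)).mp heq with h | h
        · refine ⟨l, ?_⟩
          change (((l + 1 / 2) / d : ℝ) : UnitAddCircle) = ((z : ℝ) : UnitAddCircle)
          congr 1
          rw [div_eq_iff hd'.ne']; linarith
        · refine ⟨l - 1, ?_⟩
          change (((((l - 1 : ℤ) : ℝ) + 1 / 2) / d : ℝ) : UnitAddCircle) = ((z : ℝ) : UnitAddCircle)
          congr 1
          rw [div_eq_iff hd'.ne']; push_cast; linarith
  refine measure_mono_null hsub ?_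
  have hsing : ∀ y : UnitAddCircle, (AddCircle.haarAddCircle (T := (1 : ℝ))) {y} = 0 := by
    intro y
    rw [haarAddCircle_eq_volume, ← Metric.closedBall_zero, AddCircle.volume_closedBall]
    simp
  rw [← Set.iUnion_singleton_eq_range]
  exact measure_iUnion_null fun l => hsing _

/-- If every sector meeting `E` has its index in `I`, the discretised measurement yields an index in
`I` at least with the probability of `E`. -/
lemma measureReal_le_sum_sector {d : ℕ} (hd : 0 < d) (ν : Measure UnitAddCircle)
    [IsFiniteMeasure ν] (hν : ν ≪ (AddCircle.haarAddCircle (T := (1 : ℝ))))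
    (E : Set UnitAddCircle) (I : Finset (Fin d))
    (hI : ∀ (i : Fin d), ∀ t ∈ E, t ∈ sector d i → i ∈ I) :
    ν.real E ≤ ∑ i ∈ I, ν.real (sector d i) := by
  have h0 : ν.real {t | ∀ i < d, t ∉ sector d i} = 0 := by
    rw [measureReal_def, hν (volume_compl_iUnion_sector hd)]; rfl
  have hsub : E ⊆ (⋃ i ∈ I, sector d i) ∪ {t | ∀ i < d, t ∉ sector d i} := by
    intro t ht
    by_cases h : ∀ i < d, t ∉ sector d i
    · exact Or.inr h
    · push Not at h
      obtain ⟨i, hi, hti⟩ := h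
      exact Or.inl (Set.mem_biUnion (hI ⟨i, hi⟩ t ht hti) hti)
  have h1 := (measureReal_mono hsub (μ := ν)).trans (measureReal_union_le _ _)
  rw [h0, add_zero] at h1
  exact h1.trans (measureReal_biUnion_finset_le _ _)

lemma sum_sector_le_one {d : ℕ} (ν : Measure UnitAddCircle) [IsProbabilityMeasure ν] :
    ∑ i : Fin d, ν.real (sector d i) ≤ 1 := by
  rw [← measureReal_biUnion_finset]
  · exact measureReal_le_one
  · intro i _ j _ hij
    exact sector_disjoint i.2 j.2 (by simpa [Fin.ext_iff] using hij)
  · exact fun i _ => (isOpen_sector d i).measurableSet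

/-! ### Continued fractions -/

/-- The pair of numerator and denominator of the `(j+1)`-st convergent of `x` comes from that of the
`j`-th convergent of `1 / fract x`. -/
lemma num_den_convergent_succ {x : ℝ} {j : ℕ}
    (h : 0 < (Real.convergent (Int.fract x)⁻¹ j).num) :
    (Real.convergent x (j + 1)).num =
        ⌊x⌋ * (Real.convergent (Int.fract x)⁻¹ j).num + (Real.convergent (Int.fract x)⁻¹ j).den ∧
      ((Real.convergent x (j + 1)).den : ℤ) = (Real.convergent (Int.fract x)⁻¹ j).num := by
  set c := Real.convergent (Int.fract x)⁻¹ j with hc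
  rw [Real.convergent_succ, ← hc]
  have hc0 : (c.num : ℚ) ≠ 0 := by exact_mod_cast h.ne'
  have hq : (⌊x⌋ : ℚ) + c⁻¹ = ((⌊x⌋ * c.num + c.den : ℤ) : ℚ) / (c.num : ℤ) := by
    have : c⁻¹ = (c.den : ℚ) / c.num := by
      conv_lhs => rw [← Rat.num_div_den c]
      rw [inv_div]
    rw [this]; push_cast; field_simp
  have hcop : Nat.Coprime (⌊x⌋ * c.num + c.den : ℤ).natAbs c.num.natAbs := by
    rw [← Int.isCoprime_iff_nat_coprime]
    have h1 : IsCoprime (c.den : ℤ) c.num := by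
      rw [Int.isCoprime_iff_nat_coprime]
      simpa using c.reduced.symm
    have := IsCoprime.add_mul_right_left h1 ⌊x⌋
    rwa [add_comm] at this
  rw [hq]
  exact ⟨Rat.num_div_eq_of_coprime h hcop, Rat.den_div_eq_of_coprime h hcop⟩

lemma one_lt_inv_fract {x : ℝ} (h : Int.fract x ≠ 0) : 1 < (Int.fract x)⁻¹ :=
  (one_lt_inv₀ (lt_of_le_of_ne (Int.fract_nonneg x) h.symm)).mpr (Int.fract_lt_one x)

lemma convergent_of_fract_eq_zero {x : ℝ} (h : Int.fract x = 0) (j : ℕ) :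
    Real.convergent x j = ⌊x⌋ := by
  cases j with
  | zero => rfl
  | succ j => rw [Real.convergent_succ, h, inv_zero, Real.convergent_of_zero]; simp

lemma convergent_num_pos {x : ℝ} (hx : 1 ≤ x) (j : ℕ) : 0 < (Real.convergent x j).num := by
  have hfl : 1 ≤ ⌊x⌋ := Int.le_floor.mpr (by simpa using hx)
  induction j generalizing x with
  | zero =>
      rw [Real.convergent_zero, Rat.num_intCast]
      omega
  | succ j ih =>
    by_cases h : Int.fract x = 0
    · rw [convergent_of_fract_eq_zero h, Rat.num_intCast]
      omega
    · have h1 := (one_lt_inv_fract h).le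
      have h2 := ih h1 (Int.le_floor.mpr (by simpa using h1))
      rw [(num_den_convergent_succ h2).1]
      positivity

/-- The linear form `q * num + q' * den` in a convergent. -/
noncomputable def convForm (q q' : ℤ) (x : ℝ) (j : ℕ) : ℤ :=
  q * (Real.convergent x j).num + q' * (Real.convergent x j).den

lemma convForm_zero (q q' : ℤ) (x : ℝ) : convForm q q' x 0 = q * ⌊x⌋ + q' := by
  simp [convForm, Real.convergent_zero]

lemma convForm_of_fract_eq_zero {x : ℝ} (h : Int.fract x = 0) (q q' : ℤ) (j : ℕ) :
    convForm q q' x j = q * ⌊x⌋ + q' := by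
  simp [convForm, convergent_of_fract_eq_zero h]

/-- One step of the Euclidean recursion for the denominators of the convergents. -/
lemma convForm_succ {x : ℝ} (h : Int.fract x ≠ 0) (q q' : ℤ) (j : ℕ) :
    convForm q q' x (j + 1) = convForm (q * ⌊x⌋ + q') q (Int.fract x)⁻¹ j := by
  obtain ⟨h1, h2⟩ := num_den_convergent_succ (convergent_num_pos (one_lt_inv_fract h).le j)
  rw [convForm, convForm, h1, h2]; ring

lemma convForm_le_succ {x : ℝ} {q q' : ℤ} (hq : 0 ≤ q) (hq' : 0 ≤ q * ⌊x⌋ + q') (j : ℕ) :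
    convForm q q' x j ≤ convForm q q' x (j + 1) := by
  by_cases h : Int.fract x = 0
  · rw [convForm_of_fract_eq_zero h, convForm_of_fract_eq_zero h]
  · have h1 : 1 ≤ ⌊(Int.fract x)⁻¹⌋ := Int.le_floor.mpr (by simpa using (one_lt_inv_fract h).le)
    induction j generalizing x q q' with
    | zero =>
      rw [convForm_succ h, convForm_zero, convForm_zero]
      nlinarith
    | succ j ih =>
      rw [convForm_succ h, convForm_succ h]
      by_cases h' : Int.fract (Int.fract x)⁻¹ = 0
      · rw [convForm_of_fract_eq_zero h', convForm_of_fract_eq_zero h']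
      · refine ih hq' (by positivity) h' ?_
        exact Int.le_floor.mpr (by simpa using (one_lt_inv_fract h').le)

lemma den_convergent_eq_convForm (x : ℝ) (j : ℕ) :
    ((Real.convergent x j).den : ℤ) = convForm 0 1 x j := by
  simp [convForm]

lemma monotone_den_convergent (x : ℝ) : Monotone fun j => (Real.convergent x j).den := by
  refine monotone_nat_of_le_succ fun j => ?_
  have := convForm_le_succ (x := x) (q := 0) (q' := 1) le_rfl (by simp) j
  rw [← den_convergent_eq_convForm, ← den_convergent_eq_convForm] at this
  exact_mod_cast this

/-- The error `|den * x - num|` decreases along the convergents. -/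
lemma antitone_abs_den_mul_sub_num (x : ℝ) : Antitone fun j =>
    |((Real.convergent x j).den : ℝ) * x - (Real.convergent x j).num| := by
  refine antitone_nat_of_succ_le fun j => ?_
  by_cases h : Int.fract x = 0
  · rw [convergent_of_fract_eq_zero h, convergent_of_fract_eq_zero h]
  · have key : ∀ (x : ℝ) (j : ℕ), Int.fract x ≠ 0 →
        |((Real.convergent x (j + 1)).den : ℝ) * x - (Real.convergent x (j + 1)).num| =
        Int.fract x * |((Real.convergent (Int.fract x)⁻¹ j).den : ℝ) * (Int.fract x)⁻¹ -
          (Real.convergent (Int.fract x)⁻¹ j).num| := by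
      intro x j h
      obtain ⟨h1, h2⟩ := num_den_convergent_succ (convergent_num_pos (one_lt_inv_fract h).le j)
      have h2' : ((Real.convergent x (j + 1)).den : ℝ) =
        (Real.convergent (Int.fract x)⁻¹ j).num := by exact_mod_cast h2
      rw [h1, h2']
      conv_rhs => rw [← abs_of_nonneg (Int.fract_nonneg x)]
      rw [← abs_mul, ← abs_neg]
      congr 1
      push_cast
      have hx : x = ⌊x⌋ + Int.fract x := (Int.floor_add_fract x).symm
      rw [abs_of_nonneg (Int.fract_nonneg x)]
      rw [mul_sub, mul_left_comm, mul_inv_cancel₀ h]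
      linear_combination (-((Real.convergent (Int.fract x)⁻¹ j).num : ℝ)) * hx
    induction j generalizing x with
    | zero =>
      rw [key x 0 h]
      simp only [Real.convergent_zero, Rat.den_intCast, Rat.num_intCast, Nat.cast_one, one_mul]
      rw [Int.self_sub_floor, Int.self_sub_floor, abs_of_nonneg (Int.fract_nonneg _),
        abs_of_nonneg (Int.fract_nonneg _)]
      exact mul_le_of_le_one_right (Int.fract_nonneg _) (Int.fract_lt_one _).le
    | succ j ih =>
      rw [key x (j + 1) h, key x j h]
      refine mul_le_mul_of_nonneg_left ?_ (Int.fract_nonneg _)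
      by_cases h' : Int.fract (Int.fract x)⁻¹ = 0
      · rw [convergent_of_fract_eq_zero h', convergent_of_fract_eq_zero h']
      · exact ih _ h'

/-- A fraction with denominator at most `N` that approximates `x` to within `1 / (2 N²)` is the last
convergent of `x` whose denominator does not exceed `N`. -/
lemma cfDenom_eq_den {N : ℕ} {x : ℝ} {c : ℚ} (hc : c.den ≤ N)
    (hx : |x - c| < 1 / (2 * (N : ℝ) ^ 2)) : cfDenom N x = c.den := by
  classical
  have hcd : (0 : ℝ) < c.den := by exact_mod_cast c.den_pos
  have hcN : (c.den : ℝ) ≤ N := by exact_mod_cast hc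
  have hN : (0 : ℝ) < N := hcd.trans_le hcN
  obtain ⟨j, hj⟩ := Real.exists_rat_eq_convergent (ξ := x) (q := c)
    (hx.trans_le (by gcongr))
  rw [cfDenom, Nat.findGreatest_eq_iff]
  refine ⟨hc, fun _ => ⟨j, by rw [← hj]⟩, ?_⟩
  rintro s hs hsN ⟨j', rfl⟩
  set c' := Real.convergent x j' with hc'
  have hjj : j ≤ j' := by
    by_contra hlt
    have := monotone_den_convergent x (not_le.mp hlt).le
    simp only [← hj, ← hc'] at this
    omega
  have hanti := antitone_abs_den_mul_sub_num x hjj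
  simp only [← hj, ← hc'] at hanti
  have hcc : (c'.den : ℝ) ≤ N := by exact_mod_cast hsN
  have hc'd : (0 : ℝ) < c'.den := by exact_mod_cast c'.den_pos
  have e1 : (c : ℝ) = c.num / c.den := Rat.cast_def c
  have hlam : |(c.den : ℝ) * x - c.num| < c.den / (2 * (N : ℝ) ^ 2) := by
    have : (c.den : ℝ) * x - c.num = c.den * (x - c) := by rw [e1]; field_simp
    rw [this, abs_mul, Nat.abs_cast, div_eq_mul_one_div]
    gcongr
  have hne : c.num * c'.den - c'.num * c.den ≠ 0 := by
    intro h0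
    have : c = c' := by
      rw [Rat.eq_iff_mul_eq_mul]; linarith
    rw [← this] at hs
    exact lt_irrefl _ hs
  have hge : (1 : ℝ) ≤ |(c.num : ℝ) * c'.den - c'.num * c.den| := by
    exact_mod_cast Int.one_le_abs hne
  have hle : |(c.num : ℝ) * c'.den - c'.num * c.den| ≤
      c'.den * |(c.den : ℝ) * x - c.num| + c.den * |(c'.den : ℝ) * x - c'.num| := by
    have e : (c.num : ℝ) * c'.den - c'.num * c.den =
      c.den * ((c'.den : ℝ) * x - c'.num) - c'.den * ((c.den : ℝ) * x - c.num) := by ring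
    rw [e]
    refine (abs_sub _ _).trans_eq ?_
    rw [abs_mul, abs_mul, Nat.abs_cast, Nat.abs_cast, add_comm]
  have h2 : (c'.den : ℝ) * |(c.den : ℝ) * x - c.num| + c.den * |(c'.den : ℝ) * x - c'.num| ≤
      (2 * N) * |(c.den : ℝ) * x - c.num| := by
    calc _ ≤ N * |(c.den : ℝ) * x - c.num| + N * |(c.den : ℝ) * x - c.num| := by gcongr
      _ = _ := by ring
  have h3 : (2 * N) * |(c.den : ℝ) * x - c.num| < 1 := by
    calc _ < (2 * N) * (c.den / (2 * (N : ℝ) ^ 2)) := by gcongr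
      _ ≤ (2 * N) * (N / (2 * (N : ℝ) ^ 2)) := by gcongr
      _ = 1 := by field_simp
  linarith

/-! ### The success probability -/

lemma num_mul_eq_mul_den (k : ℤ) {r : ℕ} (hr : 0 < r) :
    ((k : ℚ) / r).num * (r : ℤ) = k * ((k : ℚ) / r).den := by
  have hr' : (r : ℚ) ≠ 0 := by positivity
  have h := Rat.num_div_den ((k : ℚ) / r)
  rw [div_eq_div_iff (by exact_mod_cast ((k : ℚ) / r).den_pos.ne') hr'] at h
  exact_mod_cast h

lemma den_intCast_div_dvd (k : ℤ) {r : ℕ} (hr : 0 < r) : ((k : ℚ) / r).den ∣ r := by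
  have h : (((k : ℚ) / r).den : ℤ) ∣ ((k : ℚ) / r).num * r :=
    ⟨k, by rw [num_mul_eq_mul_den k hr]; ring⟩
  have hc : IsCoprime (((k : ℚ) / r).den : ℤ) ((k : ℚ) / r).num := by
    rw [Int.isCoprime_iff_nat_coprime]
    simpa using ((k : ℚ) / r).reduced.symm
  exact_mod_cast hc.dvd_of_dvd_mul_left h

lemma ordProj_dvd_den {k : ℤ} {r p : ℕ} (hr : 0 < r) (hp : p.Prime) (hk : ¬ (p : ℤ) ∣ k) :
    p ^ r.factorization p ∣ ((k : ℚ) / r).den := by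
  have h : ((p ^ r.factorization p : ℕ) : ℤ) ∣ k * ((k : ℚ) / r).den := by
    rw [← num_mul_eq_mul_den k hr]
    exact Dvd.dvd.mul_left (by exact_mod_cast Nat.ordProj_dvd r p) _
  have hc : IsCoprime ((p ^ r.factorization p : ℕ) : ℤ) k := by
    push_cast
    refine IsCoprime.pow_left ?_
    exact (Prime.coprime_iff_not_dvd (Nat.prime_iff_prime_int.mp hp)).mpr hk
  exact_mod_cast hc.dvd_of_dvd_mul_left h

lemma lcm_eq_of_ordProj_dvd {t r : ℕ} (hr : 0 < r) (s : Fin t → ℕ) (h1 : ∀ j, s j ∣ r)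
    (h2 : ∀ p ∈ r.primeFactors, ∃ j, p ^ r.factorization p ∣ s j) : Finset.univ.lcm s = r := by
  refine Nat.dvd_antisymm (Finset.lcm_dvd fun j _ => h1 j) ?_
  refine (Nat.dvd_iff_prime_pow_dvd_dvd _ _).mpr fun p e hp hpe => ?_
  rcases Nat.eq_zero_or_pos e with rfl | he
  · simp
  have hpr : p ∈ r.primeFactors :=
    Nat.mem_primeFactors.mpr ⟨hp, (dvd_pow_self p he.ne').trans hpe, hr.ne'⟩
  obtain ⟨j, hj⟩ := h2 p hpr
  have he' : e ≤ r.factorization p := (hp.pow_dvd_iff_le_factorization hr.ne').mp hpe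
  exact ((pow_dvd_pow p he').trans hj).trans (Finset.dvd_lcm (Finset.mem_univ j))

/-- Independent draws whose values `s i` divide `r` with probability at least `1 - ε` and contain
the full power of each prime factor of `r` with probability at least `(1 - ε) / 2`: a union bound
over the prime factors for the event that the least common multiple is `r`. -/
lemma le_sum_prod_of_lcm_eq {d t r : ℕ} (hr : 0 < r) (w : Fin d → ℝ) (hw : ∀ i, 0 ≤ w i)
    (hw1 : ∑ i, w i ≤ 1) (s : Fin d → ℕ) {ε : ℝ} (hε : ε ≤ 1)
    (hG : 1 - ε ≤ ∑ i with s i ∣ r, w i)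
    (hI : ∀ p ∈ r.primeFactors, (1 - ε) / 2 ≤ ∑ i with p ^ r.factorization p ∣ s i, w i) :
    (1 - ε) ^ t - r.primeFactors.card * ((1 + ε) / 2) ^ t ≤
      ∑ ω : Fin t → Fin d, if Finset.univ.lcm (fun j => s (ω j)) = r then ∏ j, w (ω j) else 0 := by
  classical
  have hpow : ∀ S : Finset (Fin d), (∑ i ∈ S, w i) ^ t =
      ∑ ω : Fin t → Fin d, if ∀ j, ω j ∈ S then ∏ j, w (ω j) else 0 := by
    intro S
    rw [← Finset.sum_filter]
    have := Finset.prod_univ_sum (fun _ : Fin t => S) (fun _ i => w i)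
    rw [Finset.prod_const, Finset.card_univ, Fintype.card_fin] at this
    rw [this]
    refine Finset.sum_congr ?_ fun _ _ => rfl
    ext ω; simp
  have hcompl : ∀ p ∈ r.primeFactors,
      (∑ i with ¬ p ^ r.factorization p ∣ s i, w i) ^ t ≤ ((1 + ε) / 2) ^ t := by
    intro p hp
    refine pow_le_pow_left₀ (Finset.sum_nonneg fun i _ => hw i) ?_ t
    have := Finset.sum_filter_add_sum_filter_not Finset.univ
      (fun i => p ^ r.factorization p ∣ s i) w
    have := hI p hp
    linarith
  calc _ ≤ (∑ i with s i ∣ r, w i) ^ t -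
        ∑ p ∈ r.primeFactors, (∑ i with ¬ p ^ r.factorization p ∣ s i, w i) ^ t := by
        have h1 := pow_le_pow_left₀ (by linarith) hG t
        have h2 := Finset.sum_le_card_nsmul _ _ _ hcompl
        rw [nsmul_eq_mul] at h2
        linarith
    _ = ∑ ω : Fin t → Fin d, ((if ∀ j, ω j ∈ ({i | s i ∣ r} : Finset (Fin d)) then
          ∏ j, w (ω j) else 0) - ∑ p ∈ r.primeFactors,
          if ∀ j, ω j ∈ ({i | ¬ p ^ r.factorization p ∣ s i} : Finset (Fin d)) then
            ∏ j, w (ω j) else 0) := by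
        rw [Finset.sum_sub_distrib, Finset.sum_comm, hpow]
        simp_rw [hpow]
    _ ≤ _ := by
        refine Finset.sum_le_sum fun ω _ => ?_
        simp only [Finset.mem_filter, Finset.mem_univ, true_and]
        have hW : 0 ≤ ∏ j, w (ω j) := Finset.prod_nonneg fun j _ => hw _
        have hterm : ∀ p ∈ r.primeFactors,
            0 ≤ if ∀ j, ¬ p ^ r.factorization p ∣ s (ω j) then ∏ j, w (ω j) else 0 := by
          intro p _
          split_ifs
          · exact hW
          · exact le_rfl
        have hsum := Finset.sum_nonneg hterm
        by_cases hl : Finset.univ.lcm (fun j => s (ω j)) = r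
        · rw [if_pos hl]
          split_ifs <;> linarith
        · rw [if_neg hl]
          by_cases h1 : ∀ j, s (ω j) ∣ r
          · have h2 : ∃ p ∈ r.primeFactors, ∀ j, ¬ p ^ r.factorization p ∣ s (ω j) := by
              by_contra hcon
              push Not at hcon
              exact hl (lcm_eq_of_ordProj_dvd hr _ h1 hcon)
            obtain ⟨p, hp, hpj⟩ := h2
            have h3 := Finset.single_le_sum hterm hp
            rw [if_pos hpj] at h3
            rw [if_pos h1]
            linarith
          · rw [if_neg h1]
            linarith

section order
variable {B : Type*} [CommGroup B] [Finite B]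

/-- The success probability in terms of a bound `ε` for the probability that the outcome of a single
run is not within `1 / d` of a fraction `k / r`. -/
lemma le_successProb (a : B) {n M d t : ℕ} {ε : ℝ} (hcard : Nat.card B ≤ 2 ^ n)
    (hd : 3 * (2 ^ n) ^ 2 ≤ d) (hε : Nat.card B * (d : ℝ) ^ 2 / (4 * (2 * M + 1)) ≤ ε) (hε1 : ε ≤ 1) :
    (1 - ε) ^ t - n * ((1 + ε) / 2) ^ t ≤ successProb n M d t a := by
  have hr := orderOf_pos a
  have hd0 : 0 < d := lt_of_lt_of_le (by positivity) hd
  have hd' : (0 : ℝ) < d := by exact_mod_cast hd0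
  have hrn : orderOf a ≤ 2 ^ n := (orderOf_le_card).trans hcard
  obtain ⟨f, hfm, hfst, hfb⟩ := exists_density a M
  have hε0 : 0 ≤ ε := le_trans (by positivity) hε
  unfold successProb cfOrder
  generalize orderOf a = r at hr hrn hfst hfb
  set ν := (AddCircle.haarAddCircle (T := (1 : ℝ))).withDensity fun t => f (r • t) with hν
  have : IsProbabilityMeasure ν := by rw [← hfst]; infer_instance
  have hac : ν ≪ (AddCircle.haarAddCircle (T := (1 : ℝ))) := withDensity_absolutelyContinuous _ _
  have hout : ∀ i, outcomeProb (shorOutput a M) d i = ν.real (sector d i) := by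
    intro i
    rw [← hfst, measureReal_def, Measure.fst_apply (isOpen_sector d i).measurableSet]
    rfl
  have hr1 : (1 : ℝ) ≤ r := by exact_mod_cast hr
  have hnear : 1 - ε ≤ ν.real (nearFractions r (1 / d) fun _ => True) := by
    refine one_sub_le_measureReal_nearFractions hr f hε0 fun y hy => ?_
    have hd1 : 1 / (d : ℝ) ≤ r * (1 / d) := le_mul_of_one_le_left (by positivity) hr1
    refine (hfb (1 / d) y (by positivity) (hd1.trans hy)).trans (ENNReal.ofReal_le_ofReal ?_)
    refine le_trans (le_of_eq ?_) hε
    field_simp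
  have hsec : ∀ (Q : ℤ → Prop) (hQ : ∀ k m, Q k → Q (k + r * m)) (i : Fin d),
      ∀ t ∈ nearFractions r (1 / d) Q, t ∈ sector d i →
        ∃ k : ℤ, Q k ∧ cfDenom (2 ^ n) (((i : ℕ) : ℝ) / d) = ((k : ℚ) / r).den := by
    rintro Q hQ i t ⟨k, hk, hkt⟩ hti
    have hti' : ‖t - _‖ < _ := hti
    rw [norm_sub_rev] at hti'
    have h1 : ‖((((i : ℕ) : ℝ) / d : ℝ) : UnitAddCircle) - (((k : ℝ) / r : ℝ) : UnitAddCircle)‖ <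
        1 / (2 * ((2 ^ n : ℕ) : ℝ) ^ 2) := by
      have e := sub_add_sub_cancel ((((i : ℕ) : ℝ) / d : ℝ) : UnitAddCircle) t
        (((k : ℝ) / r : ℝ) : UnitAddCircle)
      rw [← e]
      refine (norm_add_le _ _).trans_lt ((add_lt_add hti' hkt).trans_le ?_)
      have h3 : (3 : ℝ) * ((2 ^ n : ℕ) : ℝ) ^ 2 ≤ d := by exact_mod_cast hd
      have e2 : 1 / (2 * (d : ℝ)) + 1 / d = 3 / (2 * d) := by field_simp; norm_num
      rw [e2, div_le_div_iff₀ (by positivity) (by positivity)]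
      linarith
    obtain ⟨m, hm⟩ := exists_int_abs_sub_lt hr h1
    refine ⟨k + r * m, hQ k m hk, cfDenom_eq_den ?_ ?_⟩
    · exact (Nat.le_of_dvd hr (den_intCast_div_dvd _ hr)).trans hrn
    · push_cast at hm ⊢
      exact hm
  have hmain := le_sum_prod_of_lcm_eq (t := t) hr (fun i : Fin d => ν.real (sector d i))
    (fun _ => measureReal_nonneg) (sum_sector_le_one ν)
    (fun i => cfDenom (2 ^ n) (((i : ℕ) : ℝ) / d)) hε1
    (hnear.trans (measureReal_le_sum_sector hd0 ν hac _ _ fun i t ht hti => by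
      obtain ⟨k, -, hk⟩ := hsec (fun _ => True) (fun _ _ _ => trivial) i t ht hti
      simp only [Finset.mem_filter, Finset.mem_univ, true_and, hk]
      exact den_intCast_div_dvd k hr))
    (fun p hp => by
      have hpp := Nat.prime_of_mem_primeFactors hp
      have h1 := measureReal_nearFractions_not_dvd hr f (1 / d) hpp.one_lt
      have h2 := measureReal_le_sum_sector hd0 ν hac
        (nearFractions r (1 / d) fun k => ¬ (p : ℤ) ∣ k)
        {i | p ^ r.factorization p ∣ cfDenom (2 ^ n) (((i : ℕ) : ℝ) / d)}
        fun i t ht hti => by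
          obtain ⟨k, hk', hk⟩ := hsec (fun k => ¬ (p : ℤ) ∣ k) (fun k m hk h => hk (by
            have hpr : (p : ℤ) ∣ r * m :=
              Dvd.dvd.mul_right (by exact_mod_cast Nat.dvd_of_mem_primeFactors hp) _
            exact (dvd_add_left hpr).mp h)) i t ht hti
          simp only [Finset.mem_filter, Finset.mem_univ, true_and, hk]
          exact ordProj_dvd_den hr hpp hk'
      linarith)
  have hcardp : r.primeFactors.card ≤ n := by
    have h1 : 2 ^ r.primeFactors.card ≤ ∏ p ∈ r.primeFactors, p :=
      Finset.pow_card_le_prod _ _ _ fun p hp => (Nat.prime_of_mem_primeFactors hp).two_le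
    have h2 := Nat.le_of_dvd hr (Nat.prod_primeFactors_dvd r)
    exact (Nat.pow_le_pow_iff_right (by norm_num)).mp (h1.trans (h2.trans hrn))
  simp_rw [hout]
  refine le_trans ?_ hmain
  have : (r.primeFactors.card : ℝ) * ((1 + ε) / 2) ^ t ≤ n * ((1 + ε) / 2) ^ t :=
    mul_le_mul_of_nonneg_right (by exact_mod_cast hcardp) (by positivity)
  linarith

/-- Fidelity of the square pulse with the Fourier state `|0⟩ ⊗ |1⟩`. -/
lemma isApproxFourierState_approxZero {M d : ℕ} (hd : 0 < d)
    (h : 3 * Nat.card B * d ^ 2 ≤ 2 * M + 1) :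
    IsApproxFourierState d 0 (1 : B) (approxZero B M) := by
  rw [approxZero_eq_shorOutput, IsApproxFourierState]
  have hd' : (0 : ℝ) < d := by exact_mod_cast hd
  obtain ⟨f, hfm, hfst, hfb⟩ := exists_density (1 : B) M
  rw [orderOf_one] at hfst
  have : IsProbabilityMeasure ((AddCircle.haarAddCircle (T := (1 : ℝ))).withDensity
      fun t => f (1 • t)) := by rw [← hfst]; infer_instance
  have h1 := one_sub_le_measureReal_nearFractions (r := 1) (δ := 1 / (2 * d)) (ε := 1 / 3)
    one_pos f (by norm_num) (fun y hy => by
      refine (hfb (1 / (2 * d)) y (by positivity) (by simpa using hy)).trans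
        (ENNReal.ofReal_le_ofReal ?_)
      have h' : (3 : ℝ) * Nat.card B * d ^ 2 ≤ 2 * M + 1 := by exact_mod_cast h
      rw [div_le_div_iff₀ (by positivity) (by norm_num)]
      field_simp
      linarith)
  have hnear : nearFractions 1 (1 / (2 * (d : ℝ))) (fun _ => True) ⊆ sector d 0 := by
    rintro t ⟨k, -, hk⟩
    have e : (((k : ℝ) / (1 : ℕ) : ℝ) : UnitAddCircle) = 0 := by
      rw [AddCircle.coe_eq_zero_iff]; exact ⟨k, by simp⟩
    rw [e] at hk
    simpa [sector] using hk
  have h2 := measureReal_mono hnear (μ := (AddCircle.haarAddCircle (T := (1 : ℝ))).withDensity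
      fun t => f (1 • t))
  rw [← hfst, measureReal_def (s := sector d 0),
    Measure.fst_apply (isOpen_sector d 0).measurableSet, ← measureReal_def] at h2
  rw [← hfst] at h1
  have hnull : (measureT (shorOutput (1 : B) M)).real
      (⋃ (b : BReg B) (_ : b ≠ BReg.of 1), Set.univ ×ˢ {b}) = 0 := by
    rw [measureReal_def, measure_iUnion_null fun b => measure_iUnion_null fun hb => ?_]
    · rfl
    · rw [measureT_shorOutput_prod _ _ _ MeasurableSet.univ]
      simp [amplitude, Ne.symm hb]
  have hsub : (Prod.fst ⁻¹' sector d 0 : Set (GT B)) ⊆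
      {g | g.1 ∈ sector d 0 ∧ g.2 = BReg.of 1} ∪
      ⋃ (b : BReg B) (_ : b ≠ BReg.of 1), Set.univ ×ˢ {b} := by
    intro g hg
    by_cases hb : g.2 = BReg.of 1
    · exact Or.inl ⟨hg, hb⟩
    · exact Or.inr (by simpa using hb)
  have h3 := (measureReal_mono hsub (μ := measureT (shorOutput (1 : B) M))).trans
    (measureReal_union_le _ _)
  rw [hnull, add_zero] at h3
  linarith

end order

/-- The numerical estimate for `P = 2 ^ (n + k)`, `d = 4 P²`, `M = d³`, `t = 3 (n + k + 1)`. -/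
lemma one_sub_half_pow_le (n k : ℕ) {ε : ℝ} (hε : ε = 2 ^ n / (32 * (2 ^ (n + k)) ^ 2)) :
    1 - (1 / 2 : ℝ) ^ k ≤
      (1 - ε) ^ (3 * (n + k + 1)) - n * ((1 + ε) / 2) ^ (3 * (n + k + 1)) := by
  have hn2 : (1 : ℝ) ≤ 2 ^ n := one_le_pow₀ (by norm_num)
  have hk2 : (1 : ℝ) ≤ 2 ^ k := one_le_pow₀ (by norm_num)
  have hP : (n + k + 1 : ℝ) ≤ 2 ^ (n + k) := by exact_mod_cast Nat.lt_two_pow_self (n := n + k)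
  have hε0 : 0 ≤ ε := by rw [hε]; positivity
  have hε2 : ε ≤ 1 / 2 := by
    rw [hε, pow_add, div_le_div_iff₀ (by positivity) (by norm_num)]
    have : (1 : ℝ) ≤ 2 ^ n * 2 ^ k * 2 ^ k :=
      one_le_mul_of_one_le_of_one_le (one_le_mul_of_one_le_of_one_le hn2 hk2) hk2
    nlinarith
  have h1 : 1 - (1 / 2 : ℝ) ^ k / 2 ≤ (1 - ε) ^ (3 * (n + k + 1)) := by
    have hb := one_add_mul_le_pow (a := -ε) (by linarith) (3 * (n + k + 1))
    rw [← sub_eq_add_neg] at hb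
    have hmul : ((3 * (n + k + 1) : ℕ) : ℝ) * ε ≤ (1 / 2) ^ k / 2 := by
      have h3 : ((3 * (n + k + 1) : ℕ) : ℝ) ≤ 3 * 2 ^ (n + k) := by push_cast; linarith
      calc ((3 * (n + k + 1) : ℕ) : ℝ) * ε ≤ 3 * 2 ^ (n + k) * ε := by gcongr
        _ = 3 / 32 * (1 / 2) ^ k := by
            rw [hε, pow_add, one_div, inv_pow]; field_simp
        _ ≤ _ := by
            have : (0 : ℝ) < (1 / 2) ^ k := by positivity
            linarith
    linarith
  have h2 : (n : ℝ) * ((1 + ε) / 2) ^ (3 * (n + k + 1)) ≤ (1 / 2) ^ k / 2 := by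
    have h3 : ((1 + ε) / 2) ^ (3 * (n + k + 1)) ≤ (1 / 2) ^ (n + k + 1) := by
      rw [pow_mul]
      refine pow_le_pow_left₀ (by positivity) ?_ _
      calc ((1 + ε) / 2) ^ 3 ≤ (3 / 4) ^ 3 := pow_le_pow_left₀ (by positivity) (by linarith) 3
        _ ≤ 1 / 2 := by norm_num
    have h4 : (n : ℝ) ≤ 2 ^ n := by exact_mod_cast (Nat.lt_two_pow_self (n := n)).le
    calc _ ≤ 2 ^ n * (1 / 2 : ℝ) ^ (n + k + 1) := by gcongr
      _ = (1 / 2) ^ k / 2 := by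
        rw [pow_add, pow_add, ← mul_assoc, ← mul_assoc, ← mul_pow]; norm_num; ring
  linarith

/-! ### Cost-bounded Hoare logic for the random access machine -/

@[simp] lemma Store.setReg_reg (σ : Store) (x v y : ℕ) :
    (σ.setReg x v).reg y = if y = x then v else σ.reg y := by
  simp [Store.setReg, Function.update_apply]

@[simp] lemma Store.setReg_mem (σ : Store) (x v : ℕ) : (σ.setReg x v).mem = σ.mem := rfl

/-- All numbers in the store have at most `S` bits. -/
def Store.Bounded (S : ℕ) (σ : Store) : Prop :=
  (∀ i, σ.reg i < 2 ^ S) ∧ ∀ i, σ.mem i < 2 ^ S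

lemma Store.Bounded.setReg {S : ℕ} {σ : Store} (h : σ.Bounded S) {v : ℕ} (hv : v < 2 ^ S) (x : ℕ) :
    (σ.setReg x v).Bounded S := by
  refine ⟨fun i => ?_, h.2⟩
  rw [Store.setReg_reg]
  split_ifs
  · exact hv
  · exact h.1 i

/-- Started in `σ`, the program `P` halts at cost at most `C` in a store of `S`-bit numbers that
satisfies `post`. -/
def Runs (S : ℕ) (P : Prog) (σ : Store) (C : ℕ) (post : Store → Prop) : Prop :=
  ∃ τ c, Exec P σ τ c ∧ c ≤ C ∧ τ.Bounded S ∧ post τ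

namespace Runs
variable {S : ℕ} {σ : Store} {post : Store → Prop}

lemma mono {P : Prog} {C C' : ℕ} {post' : Store → Prop} (h : Runs S P σ C post) (hC : C ≤ C')
    (hp : ∀ τ, τ.Bounded S → post τ → post' τ) : Runs S P σ C' post' := by
  obtain ⟨τ, c, h1, h2, h3, h4⟩ := h
  exact ⟨τ, c, h1, h2.trans hC, h3, hp τ h3 h4⟩

lemma seq {P Q : Prog} {C E : ℕ} {mid : Store → Prop} (h : Runs S P σ C mid)
    (h' : ∀ τ, τ.Bounded S → mid τ → Runs S Q τ E post) : Runs S (.seq P Q) σ (C + E) post := by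
  obtain ⟨τ, c, h1, h2, h3, h4⟩ := h
  obtain ⟨υ, e, h5, h6, h7, h8⟩ := h' τ h3 h4
  exact ⟨υ, c + e, .seq h1 h5, by omega, h7, h8⟩

lemma skip (hσ : σ.Bounded S) (hp : post σ) : Runs S .skip σ 1 post :=
  ⟨σ, 1, .skip σ, le_rfl, hσ, hp⟩

lemma const (hσ : σ.Bounded S) {x v : ℕ} (hv : v < 2 ^ S)
    (hp : (σ.setReg x v).Bounded S → post (σ.setReg x v)) :
    Runs S (.const x v) σ (1 + 3 * S) post :=
  ⟨_, _, .const σ x v, by have := Nat.size_le.mpr hv; omega, hσ.setReg hv x, hp (hσ.setReg hv x)⟩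

lemma op (hσ : σ.Bounded S) {o : Op} {x y z : ℕ} (v : ℕ) (he : o.eval (σ.reg y) (σ.reg z) = v)
    (hv : v < 2 ^ S) (hp : (σ.setReg x v).Bounded S → post (σ.setReg x v)) :
    Runs S (.op o x y z) σ (1 + 3 * S) post := by
  subst he
  refine ⟨_, _, .op σ o x y z, ?_, hσ.setReg hv x, hp (hσ.setReg hv x)⟩
  have h1 := Nat.size_le.mpr hv
  have h2 := Nat.size_le.mpr (hσ.1 y)
  have h3 := Nat.size_le.mpr (hσ.1 z)
  omega

lemma const_seq {Q : Prog} {E : ℕ} (hσ : σ.Bounded S) {x v : ℕ} (hv : v < 2 ^ S)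
    (h : (σ.setReg x v).Bounded S → Runs S Q (σ.setReg x v) E post) :
    Runs S (.seq (.const x v) Q) σ (1 + 3 * S + E) post :=
  seq (const (post := fun τ => τ = σ.setReg x v) hσ hv fun _ => rfl)
    fun _ hb e => by subst e; exact h hb

lemma op_seq {Q : Prog} {E : ℕ} (hσ : σ.Bounded S) {o : Op} {x y z : ℕ} (v : ℕ)
    (he : o.eval (σ.reg y) (σ.reg z) = v) (hv : v < 2 ^ S)
    (h : (σ.setReg x v).Bounded S → Runs S Q (σ.setReg x v) E post) :
    Runs S (.seq (.op o x y z) Q) σ (1 + 3 * S + E) post :=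
  seq (op (post := fun τ => τ = σ.setReg x v) hσ v he hv fun _ => rfl)
    fun _ hb e => by subst e; exact h hb

lemma load_seq {Q : Prog} {E : ℕ} (hσ : σ.Bounded S) {x y : ℕ} (v : ℕ)
    (he : σ.mem (σ.reg y) = v) (h : (σ.setReg x v).Bounded S → Runs S Q (σ.setReg x v) E post) :
    Runs S (.seq (.load x y) Q) σ (1 + 3 * S + E) post := by
  subst he
  have hv := hσ.2 (σ.reg y)
  refine seq (mid := fun τ => τ = σ.setReg x (σ.mem (σ.reg y)))
    ⟨_, _, .load σ x y, ?_, hσ.setReg hv x, rfl⟩ fun _ hb e => by subst e; exact h hb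
  have h1 := Nat.size_le.mpr (hσ.1 y)
  have h2 := Nat.size_le.mpr hv
  omega

lemma ite {P Q : Prog} {x C : ℕ} (hσ : σ.Bounded S) (hP : σ.reg x ≠ 0 → Runs S P σ C post)
    (hQ : σ.reg x = 0 → Runs S Q σ C post) : Runs S (.ite x P Q) σ (1 + S + C) post := by
  by_cases h : σ.reg x = 0
  · obtain ⟨τ, c, h1, h2, h3, h4⟩ := hQ h
    exact ⟨τ, _, .ite_false h h1, by omega, h3, h4⟩
  · obtain ⟨τ, c, h1, h2, h3, h4⟩ := hP h
    have := Nat.size_le.mpr (hσ.1 x)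
    exact ⟨τ, _, .ite_true h h1, by omega, h3, h4⟩

/-- The rule for loops: the invariant carries a bound `I` for the number of remaining rounds. -/
lemma loop {P : Prog} {x C : ℕ} (Inv : ℕ → Store → Prop)
    (hstep : ∀ I τ, τ.Bounded S → Inv I τ → τ.reg x ≠ 0 →
      ∃ I', I = I' + 1 ∧ Runs S P τ C (Inv I')) :
    ∀ (I : ℕ) (σ : Store), σ.Bounded S → Inv I σ →
      Runs S (.loop x P) σ (I * (1 + S + C) + 1) fun τ => τ.reg x = 0 ∧ ∃ I', Inv I' τ := by
  intro I
  induction I with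
  | zero =>
    intro σ hσ hI
    by_cases h : σ.reg x = 0
    · exact ⟨σ, 1, .loop_false h, by omega, hσ, h, 0, hI⟩
    · obtain ⟨I', h1, -⟩ := hstep 0 σ hσ hI h
      omega
  | succ I ih =>
    intro σ hσ hI
    by_cases h : σ.reg x = 0
    · exact ⟨σ, 1, .loop_false h, by omega, hσ, h, I + 1, hI⟩
    · obtain ⟨I', h1, τ, c, h2, h3, h4, h5⟩ := hstep _ σ hσ hI h
      obtain rfl : I = I' := by omega
      obtain ⟨υ, e, h6, h7, h8, h9⟩ := ih τ h4 h5
      have := Nat.size_le.mpr (hσ.1 x)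
      refine ⟨υ, _, .loop_true h h2 h6, ?_, h8, h9⟩
      rw [Nat.add_mul]
      omega

end Runs

/-! ### Powers of two -/

/-- Doubles register `6` as often as register `16` says; register `5` holds `1`. -/
def powProg : Prog :=
  .loop 16 (.seq (.op .add 6 6 6) (.op .sub 16 16 5))

lemma powProg_runs {S m : ℕ} {σ : Store} (hσ : σ.Bounded S) (h5 : σ.reg 5 = 1) (h6 : σ.reg 6 = 1)
    (h16 : σ.reg 16 = m) (hS : 2 ^ m < 2 ^ S) :
    Runs S powProg σ (m * (1 + S + (1 + 3 * S + (1 + 3 * S))) + 1) fun τ =>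
      τ.reg 6 = 2 ^ m ∧ (∀ i, i ≠ 6 → i ≠ 16 → τ.reg i = σ.reg i) ∧ τ.mem = σ.mem := by
  refine (Runs.loop (fun I τ => τ.reg 16 = I ∧ τ.reg 6 * 2 ^ I = 2 ^ m ∧
    (∀ i, i ≠ 6 → i ≠ 16 → τ.reg i = σ.reg i) ∧ τ.mem = σ.mem) ?_ m σ hσ
    ⟨h16, by simp [h6], fun _ _ _ => rfl, rfl⟩).mono le_rfl ?_
  · rintro I τ hτ ⟨hI, hpow, hreg, hmem⟩ hne
    obtain ⟨I', rfl⟩ := Nat.exists_eq_succ_of_ne_zero (hI ▸ hne)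
    have hpow' : (τ.reg 6 + τ.reg 6) * 2 ^ I' = 2 ^ m := by
      rw [← hpow, Nat.succ_eq_add_one, pow_succ]; ring
    have h5' : τ.reg 5 = 1 := (hreg 5 (by decide) (by decide)).trans h5
    refine ⟨I', rfl, Runs.op_seq hτ (τ.reg 6 + τ.reg 6) rfl ?_ fun hb =>
      Runs.op hb I' (by simp [Op.eval, hI, h5']) ?_ fun _ => ?_⟩
    · refine lt_of_le_of_lt ?_ hS
      rw [← hpow']
      exact Nat.le_mul_of_pos_right _ (by positivity)
    · have := hτ.1 16
      omega
    · refine ⟨by simp, by simpa using hpow', fun i h h' => ?_, hmem⟩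
      simp [h, h', hreg i h h']
  · rintro τ - ⟨h0, I, hI, hpow, hreg, hmem⟩
    obtain rfl : I = 0 := hI.symm.trans h0
    exact ⟨by simpa using hpow, hreg, hmem⟩

/-! ### The Euclidean algorithm with continued-fraction denominators -/

/-- The Euclidean algorithm on `(a, b)` with the recursion `(q, q') ↦ (q * (a / b) + q', q)` for the
denominators of the convergents; returns the last denominator that does not exceed `N`, or `best` if
there is none. -/
def cfScan (N a b q q' best : ℕ) : ℕ :=
  if h : b = 0 then best
  else
    have : a % b < b := Nat.mod_lt _ (Nat.pos_of_ne_zero h)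
    cfScan N b (a % b) (q * (a / b) + q') q
      (if q * (a / b) + q' ≤ N then q * (a / b) + q' else best)
termination_by b

lemma cfScan_zero (N a q q' best : ℕ) : cfScan N a 0 q q' best = best := by
  rw [cfScan]; simp

lemma cfScan_of_ne_zero (N a q q' best : ℕ) {b : ℕ} (h : b ≠ 0) :
    cfScan N a b q q' best = cfScan N b (a % b) (q * (a / b) + q') q
      (if q * (a / b) + q' ≤ N then q * (a / b) + q' else best) := by
  rw [cfScan]; simp [h]

lemma floor_natCast_div_natCast (a b : ℕ) : ⌊(a : ℝ) / b⌋ = ((a / b : ℕ) : ℤ) := by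
  rw [Int.floor_div_natCast, Int.floor_natCast]; norm_cast

/-- The scan returns the largest number not exceeding `N` among `best` and the denominators that the
recursion produces. These increase, and the hypothesis on `best` puts it below the first of them. -/
lemma cfScan_spec (N a b q q' best : ℕ) (hb : b ≠ 0) (hN : best ≤ N)
    (hbest : best ≤ q * (a / b) + q') :
    best ≤ cfScan N a b q q' best ∧ cfScan N a b q q' best ≤ N ∧
    (cfScan N a b q q' best = best ∨
      ∃ j, (cfScan N a b q q' best : ℤ) = convForm q q' ((a : ℝ) / b) j) ∧
    ∀ j, convForm q q' ((a : ℝ) / b) j ≤ N →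
      convForm q q' ((a : ℝ) / b) j ≤ cfScan N a b q q' best := by
  induction b using Nat.strong_induction_on generalizing a q q' best with
  | _ b ih =>
    have hfl : ⌊(a : ℝ) / b⌋ = ((a / b : ℕ) : ℤ) := floor_natCast_div_natCast a b
    have hD0 : convForm q q' ((a : ℝ) / b) 0 = ((q * (a / b) + q' : ℕ) : ℤ) := by
      rw [convForm_zero, hfl]; push_cast; rfl
    rw [cfScan_of_ne_zero _ _ _ _ _ hb]
    set u := q * (a / b) + q' with hu
    by_cases hmod : a % b = 0
    · have hD : ∀ j, convForm q q' ((a : ℝ) / b) j = (u : ℤ) := by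
        intro j
        rw [← hD0, convForm_zero]
        exact convForm_of_fract_eq_zero (by rw [Int.fract_div_natCast_eq_div_natCast_mod, hmod]; simp) _ _ _
      simp_rw [hmod, cfScan_zero, hD]
      split_ifs with huN
      · exact ⟨hbest, huN, Or.inr ⟨0, rfl⟩, fun _ _ => le_rfl⟩
      · exact ⟨le_rfl, hN, Or.inl rfl, fun _ h => absurd (by exact_mod_cast h) huN⟩
    · have hfr : Int.fract ((a : ℝ) / b) ≠ 0 := by
        rw [Int.fract_div_natCast_eq_div_natCast_mod]
        exact div_ne_zero (by exact_mod_cast hmod) (by exact_mod_cast hb)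
      have hD : ∀ j, convForm q q' ((a : ℝ) / b) (j + 1) =
          convForm u q ((b : ℝ) / (a % b : ℕ)) j := by
        intro j
        rw [convForm_succ hfr, Int.fract_div_natCast_eq_div_natCast_mod, inv_div, hfl, hu]
        push_cast; rfl
      have hlt : a % b < b := Nat.mod_lt _ (Nat.pos_of_ne_zero hb)
      have hle : u ≤ u * (b / (a % b)) + q :=
        (Nat.le_mul_of_pos_right u (Nat.div_pos hlt.le (Nat.pos_of_ne_zero hmod))).trans
          (Nat.le_add_right _ _)
      split_ifs with huN
      · obtain ⟨h1, h2, h3, h4⟩ := ih (a % b) hlt b u q u hmod huN hle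
        refine ⟨hbest.trans h1, h2, Or.inr ?_, fun j hj => ?_⟩
        · rcases h3 with h3 | ⟨j, h3⟩
          · exact ⟨0, by rw [hD0, h3]⟩
          · exact ⟨j + 1, by rw [hD, h3]⟩
        · cases j with
          | zero => rw [hD0]; exact_mod_cast h1
          | succ j => rw [hD] at hj ⊢; exact h4 j hj
      · obtain ⟨h1, h2, h3, h4⟩ := ih (a % b) hlt b u q best hmod hN (hbest.trans hle)
        refine ⟨h1, h2, h3.imp_right fun ⟨j, h3⟩ => ⟨j + 1, by rw [hD, h3]⟩, fun j hj => ?_⟩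
        cases j with
        | zero => rw [hD0] at hj; exact absurd (by exact_mod_cast hj) huN
        | succ j => rw [hD] at hj ⊢; exact h4 j hj

/-- The scan that starts with the inverted fraction `d / i` computes `cfDenom`. -/
lemma cfScan_eq_cfDenom {N i d : ℕ} (hN : 1 ≤ N) (hi : i < d) :
    cfScan N d i 1 0 1 = cfDenom N ((i : ℝ) / d) := by
  classical
  have hd : d ≠ 0 := by omega
  have hfl : ⌊(i : ℝ) / d⌋ = 0 := by
    rw [floor_natCast_div_natCast]
    exact_mod_cast Nat.div_eq_of_lt hi
  symm
  rw [cfDenom, Nat.findGreatest_eq_iff]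
  by_cases hi0 : i = 0
  · subst hi0
    rw [cfScan_zero]
    refine ⟨hN, fun _ => ⟨0, by simp [Real.convergent_zero]⟩, ?_⟩
    rintro s hs - ⟨j, hj⟩
    simp at hj
    omega
  · have hfr : Int.fract ((i : ℝ) / d) ≠ 0 := by
      rw [Int.fract_div_natCast_eq_div_natCast_mod, Nat.mod_eq_of_lt hi]
      exact div_ne_zero (by exact_mod_cast hi0) (by exact_mod_cast hd)
    have hden : ∀ j, ((Real.convergent ((i : ℝ) / d) (j + 1)).den : ℤ) =
        convForm (1 : ℕ) (0 : ℕ) ((d : ℝ) / i) j := by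
      intro j
      rw [den_convergent_eq_convForm, convForm_succ hfr, Int.fract_div_natCast_eq_div_natCast_mod,
        Nat.mod_eq_of_lt hi, inv_div, hfl]
      simp
    have hden0 : (Real.convergent ((i : ℝ) / d) 0).den = 1 := by simp [Real.convergent_zero]
    obtain ⟨h1, h2, h3, h4⟩ := cfScan_spec N d i 1 0 1 hi0 hN
      (by have := Nat.div_pos hi.le (Nat.pos_of_ne_zero hi0); omega)
    refine ⟨h2, fun _ => ?_, ?_⟩
    · rcases h3 with h3 | ⟨j, h3⟩
      · exact ⟨0, by rw [hden0, h3]⟩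
      · exact ⟨j + 1, by rw [← hden] at h3; exact_mod_cast h3.symm⟩
    · rintro s hs hsN ⟨j, rfl⟩
      cases j with
      | zero => omega
      | succ j =>
        have := h4 j (by rw [← hden]; exact_mod_cast hsN)
        rw [← hden] at this
        have : (Real.convergent ((i : ℝ) / d) (j + 1)).den ≤ cfScan N d i 1 0 1 := by
          exact_mod_cast this
        omega

/-- One round of the Euclidean algorithm. Registers `8, 9` hold its pair `(a, b)`, `10, 11` the
pair `(q, q')`, `12` the best denominator so far, `6` the bound `N`; `13, 14, 15` are scratch and
`20` holds `0`. -/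
def euclidStep : Prog :=
  .seq (.op .div 13 8 9) (.seq (.op .mod 15 8 9) (.seq (.op .add 8 9 20)
    (.seq (.op .add 9 15 20) (.seq (.op .mul 14 10 13) (.seq (.op .add 14 14 11)
    (.seq (.op .add 11 10 20) (.seq (.op .add 10 14 20) (.seq (.op .sub 13 14 6)
      (.ite 13 .skip (.op .add 12 14 20))))))))))

/-- The Euclidean algorithm on registers `8, 9`. -/
def euclidProg : Prog := .loop 9 euclidStep

/-- The cost of `euclidStep` on `S`-bit numbers. -/
def euclidStepCost {R : Type*} [CommSemiring R] (S : R) : R :=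
  9 * (1 + 3 * S) + (1 + S + (1 + 3 * S))

/-- The cost of `euclidProg` on `S`-bit numbers. -/
def euclidCost {R : Type*} [CommSemiring R] (S : R) : R :=
  2 * S * (1 + S + euclidStepCost S) + 1

lemma euclidStep_runs {S a b q q' N best : ℕ} {σ : Store} (hσ : σ.Bounded S) (ha : σ.reg 8 = a)
    (hb : σ.reg 9 = b) (hq : σ.reg 10 = q) (hq' : σ.reg 11 = q') (hbest : σ.reg 12 = best)
    (hN : σ.reg 6 = N) (h20 : σ.reg 20 = 0) (hb0 : 0 < b) (hu : q * (a / b) + q' < 2 ^ S) :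
    Runs S euclidStep σ (euclidStepCost S) fun τ =>
      τ.reg 8 = b ∧ τ.reg 9 = a % b ∧ τ.reg 10 = q * (a / b) + q' ∧ τ.reg 11 = q ∧
      τ.reg 12 = (if q * (a / b) + q' ≤ N then q * (a / b) + q' else best) ∧
      (∀ i ∉ Finset.Icc 8 15, τ.reg i = σ.reg i) ∧ τ.mem = σ.mem := by
  have ha2 : a < 2 ^ S := ha ▸ hσ.1 8
  have hb2 : b < 2 ^ S := hb ▸ hσ.1 9
  have hq2 : q < 2 ^ S := hq ▸ hσ.1 10
  have hmod : a % b < 2 ^ S := (Nat.mod_lt _ hb0).trans hb2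
  have hframe : ∀ i ∉ Finset.Icc 8 15, ∀ j ∈ Finset.Icc 8 15, i ≠ j := by
    rintro i hi j hj rfl
    exact hi hj
  generalize hU : q * (a / b) + q' = u at hu
  refine (?_ : Runs _ _ _ _ _).mono (C := (1 + 3 * S) + ((1 + 3 * S) + ((1 + 3 * S) +
    ((1 + 3 * S) + ((1 + 3 * S) + ((1 + 3 * S) +
    ((1 + 3 * S) + ((1 + 3 * S) + ((1 + 3 * S) +
    (1 + S + (1 + 3 * S))))))))))) (by simp only [euclidStepCost]; omega) fun _ _ h => h
  refine Runs.op_seq hσ (a / b) (by simp [Op.eval, ha, hb])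
    ((Nat.div_le_self _ _).trans_lt ha2) fun h1 => ?_
  refine Runs.op_seq h1 (a % b) (by simp [Op.eval, ha, hb]) hmod fun h2 => ?_
  refine Runs.op_seq h2 b (by simp [Op.eval, hb, h20]) hb2 fun h3 => ?_
  refine Runs.op_seq h3 (a % b) (by simp [Op.eval, h20]) hmod fun h4 => ?_
  refine Runs.op_seq h4 (q * (a / b)) (by simp [Op.eval, hq]) (by omega) fun h5 => ?_
  refine Runs.op_seq h5 u (by simp [Op.eval, hq', hU]) hu fun h6 => ?_
  refine Runs.op_seq h6 q (by simp [Op.eval, hq, h20]) hq2 fun h7 => ?_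
  refine Runs.op_seq h7 u (by simp [Op.eval, h20]) hu fun h8 => ?_
  refine Runs.op_seq h8 (u - N) (by simp [Op.eval, hN]) (by omega) fun h9 => ?_
  refine Runs.ite h9 (fun hne => ?_) (fun heq => ?_)
  · have huN : ¬ u ≤ N := by simpa [Nat.sub_eq_zero_iff_le] using hne
    refine (Runs.skip h9 ?_).mono (by omega) fun _ _ h => h
    refine ⟨by simp, by simp, by simp, by simp, by simp [huN, hbest], fun i hi => ?_, rfl⟩
    have := hframe i hi
    simp [this 8, this 9, this 10, this 11, this 13, this 14, this 15]
  · have huN : u ≤ N := by simpa [Nat.sub_eq_zero_iff_le] using heq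
    refine Runs.op h9 u (by simp [Op.eval, h20]) hu fun _ => ?_
    refine ⟨by simp, by simp, by simp, by simp, by simp [huN], fun i hi => ?_, rfl⟩
    have := hframe i hi
    simp [this 8, this 9, this 10, this 11, this 12, this 13, this 14, this 15]

/-- The product `a * b` at least halves in every round, so there are at most `2 S` rounds;
`q * a + q' * b` is invariant and bounds the intermediate results. -/
lemma euclidProg_runs {S : ℕ} {σ : Store} (hσ : σ.Bounded S) (h20 : σ.reg 20 = 0)
    (hab : σ.reg 9 ≤ σ.reg 8) (hD : σ.reg 10 * σ.reg 8 + σ.reg 11 * σ.reg 9 < 2 ^ S) :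
    Runs S euclidProg σ (euclidCost S) fun τ =>
      τ.reg 12 = cfScan (σ.reg 6) (σ.reg 8) (σ.reg 9) (σ.reg 10) (σ.reg 11) (σ.reg 12) ∧
      τ.reg 8 = Nat.gcd (σ.reg 8) (σ.reg 9) ∧
      (∀ i ∉ Finset.Icc 8 15, τ.reg i = σ.reg i) ∧ τ.mem = σ.mem := by
  refine (Runs.loop (fun I τ => τ.reg 9 ≤ τ.reg 8 ∧ τ.reg 8 * τ.reg 9 < 2 ^ I ∧
    τ.reg 10 * τ.reg 8 + τ.reg 11 * τ.reg 9 < 2 ^ S ∧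
    cfScan (σ.reg 6) (τ.reg 8) (τ.reg 9) (τ.reg 10) (τ.reg 11) (τ.reg 12) =
      cfScan (σ.reg 6) (σ.reg 8) (σ.reg 9) (σ.reg 10) (σ.reg 11) (σ.reg 12) ∧
    Nat.gcd (τ.reg 8) (τ.reg 9) = Nat.gcd (σ.reg 8) (σ.reg 9) ∧
    (∀ i ∉ Finset.Icc 8 15, τ.reg i = σ.reg i) ∧ τ.mem = σ.mem)
    (C := euclidStepCost S) ?_ (2 * S) σ hσ
    ⟨hab, ?_, hD, rfl, rfl, fun _ _ => rfl, rfl⟩).mono (by simp [euclidCost]) ?_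
  · rintro I τ hτ ⟨hba, hI, hinv, hscan, hgcd, hreg, hmem⟩ hne
    have hb : 0 < τ.reg 9 := Nat.pos_of_ne_zero hne
    have ha : 0 < τ.reg 8 := hb.trans_le hba
    rw [cfScan_of_ne_zero _ _ _ _ _ hne] at hscan
    have hI0 : I ≠ 0 := by
      rintro rfl
      have := Nat.mul_pos ha hb
      omega
    obtain ⟨I', rfl⟩ := Nat.exists_eq_succ_of_ne_zero hI0
    have h20' : τ.reg 20 = 0 := (hreg 20 (by decide)).trans h20
    have h6' : τ.reg 6 = σ.reg 6 := hreg 6 (by decide)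
    generalize ha' : τ.reg 8 = a at *
    generalize hb' : τ.reg 9 = b at *
    generalize hq : τ.reg 10 = q at *
    generalize hq' : τ.reg 11 = q' at *
    have hmod : a % b < b := Nat.mod_lt _ hb
    have hdm : b * (a / b) + a % b = a := Nat.div_add_mod _ _
    have hinv' : (q * (a / b) + q') * b + q * (a % b) = q * a + q' * b := by
      conv_rhs => rw [← hdm]
      ring
    have hhalf : b * (a % b) < 2 ^ I' := by
      have h1 : 2 * (a % b) ≤ a := by
        have h2 : b ≤ b * (a / b) := Nat.le_mul_of_pos_right _ (Nat.div_pos hba hb)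
        omega
      have h3 : b * (2 * (a % b)) ≤ b * a := Nat.mul_le_mul_left _ h1
      rw [Nat.succ_eq_add_one, pow_succ] at hI
      nlinarith
    have hu : q * (a / b) + q' < 2 ^ S := by
      refine lt_of_le_of_lt ?_ hinv
      rw [← hinv']
      exact (Nat.le_mul_of_pos_right _ hb).trans (Nat.le_add_right _ _)
    refine ⟨I', rfl, (euclidStep_runs hτ ha' hb' hq hq' rfl h6' h20' hb hu).mono le_rfl ?_⟩
    rintro υ - ⟨e8, e9, e10, e11, e12, hreg', hmem'⟩
    rw [e8, e9, e10, e11, e12, hinv', ← hgcd, Nat.gcd_comm a b, Nat.gcd_rec b a,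
      Nat.gcd_comm (a % b)]
    exact ⟨hmod.le, hhalf, hinv, hscan, rfl, fun i hi => (hreg' i hi).trans (hreg i hi),
      hmem'.trans hmem⟩
  · rw [two_mul, pow_add]
    exact Nat.mul_lt_mul'' (hσ.1 8) (hσ.1 9)
  · rintro τ - ⟨h0, I, -, -, -, hscan, hgcd, hreg, hmem⟩
    rw [h0, cfScan_zero] at hscan
    rw [h0, Nat.gcd_zero_right] at hgcd
    exact ⟨hscan, hgcd, hreg, hmem⟩

/-! ### The preprocessing and post-processing programs -/

lemma getD_lt {l : List ℕ} {b : ℕ} (hb : 0 < b) (h : ∀ x ∈ l, x < b) (i : ℕ) : l.getD i 0 < b := by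
  by_cases hi : i < l.length
  · rw [List.getD_eq_getElem _ _ hi]
    exact h _ (List.getElem_mem hi)
  · rw [List.getD_eq_default _ _ (not_lt.mp hi)]
    exact hb

lemma Store.init_bounded {S : ℕ} {regs mem : List ℕ} (h : ∀ x ∈ regs, x < 2 ^ S)
    (h' : ∀ x ∈ mem, x < 2 ^ S) : (Store.init regs mem).Bounded S :=
  ⟨getD_lt (by positivity) h, getD_lt (by positivity) h'⟩

/-- Computes `M = d³`, `d = 4 P²`, `t = 3 (n + k + 1)`, where `P = 2 ^ (n + k)`. -/
def preProg : Prog :=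
  .seq (.const 5 1) (.seq (.op .add 16 0 1) (.seq (.op .add 4 16 5) (.seq (.const 13 3)
    (.seq (.op .mul 2 4 13) (.seq (.const 6 1) (.seq powProg (.seq (.op .mul 13 6 6)
    (.seq (.const 14 4) (.seq (.op .mul 1 13 14) (.seq (.op .mul 13 1 1) (.op .mul 0 13 1)))))))))))

/-- The cost of `powProg` on `S`-bit numbers for the exponent `m`. -/
def powCost {R : Type*} [CommSemiring R] (S m : R) : R :=
  m * (1 + S + (1 + 3 * S + (1 + 3 * S))) + 1

lemma preProg_runs {n k S : ℕ} (hS : 6 * (n + k) + 7 ≤ S) :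
    Runs S preProg (Store.init [n, k] []) (11 * (1 + 3 * S) + powCost S (n + k)) fun τ =>
      τ.reg 0 = (4 * (2 ^ (n + k)) ^ 2) ^ 3 ∧ τ.reg 1 = 4 * (2 ^ (n + k)) ^ 2 ∧
      τ.reg 2 = 3 * (n + k + 1) := by
  have hlt : ∀ e, e ≤ 6 * (n + k) + 6 → 2 ^ e < 2 ^ S := fun e he =>
    Nat.pow_lt_pow_right (by norm_num) (by omega)
  have hnk : n + k < 2 ^ (n + k) := Nat.lt_two_pow_self
  have hP := hlt (n + k) (by omega)
  have hP2 : 2 ^ (n + k) * 2 ^ (n + k) < 2 ^ S := by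
    rw [← pow_add]; exact hlt _ (by omega)
  have e4 : 4 * (2 ^ (n + k)) ^ 2 = 2 ^ (2 * (n + k) + 2) := by
    rw [← pow_mul, pow_add]; ring
  have h4 : 4 < 2 ^ S := hlt 2 (by omega)
  have ht : 3 * (n + k + 1) < 2 ^ S := by
    have := hlt (n + k + 2) (by omega)
    rw [pow_add] at this
    omega
  have h0 : (Store.init [n, k] []).Bounded S :=
    Store.init_bounded (by simp; omega) (by simp)
  have r0 : (Store.init [n, k] []).reg 0 = n := rfl
  have r1 : (Store.init [n, k] []).reg 1 = k := rfl
  refine (?_ : Runs _ _ _ _ _).mono (C := (1 + 3 * S) + ((1 + 3 * S) + ((1 + 3 * S) +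
    ((1 + 3 * S) + ((1 + 3 * S) + ((1 + 3 * S) + (powCost S (n + k) + ((1 + 3 * S) +
    ((1 + 3 * S) + ((1 + 3 * S) + ((1 + 3 * S) + (1 + 3 * S))))))))))))
    (by omega) fun _ _ h => h
  refine Runs.const_seq h0 (by omega) fun h1 => ?_
  refine Runs.op_seq h1 (n + k) (by simp [Op.eval, r0, r1]) (by omega) fun h2 => ?_
  refine Runs.op_seq h2 (n + k + 1) (by simp [Op.eval]) (by omega) fun h3 => ?_
  refine Runs.const_seq h3 (by omega) fun h4' => ?_
  refine Runs.op_seq h4' (3 * (n + k + 1)) (by simp [Op.eval]; ring) ht fun h5 => ?_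
  refine Runs.const_seq h5 (by omega) fun h6 => ?_
  refine Runs.seq (powProg_runs (m := n + k) h6 (by simp) (by simp) (by simp) hP) ?_
  rintro τ hτ ⟨hpow, hreg, -⟩
  have h2τ : τ.reg 2 = 3 * (n + k + 1) := by
    rw [hreg 2 (by decide) (by decide)]; simp
  refine Runs.op_seq hτ (2 ^ (n + k) * 2 ^ (n + k)) (by simp [Op.eval, hpow]) hP2 fun h7 => ?_
  refine Runs.const_seq h7 h4 fun h8 => ?_
  refine Runs.op_seq h8 (4 * (2 ^ (n + k)) ^ 2) (by simp [Op.eval]; ring)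
    (by rw [e4]; exact hlt _ (by omega)) fun h9 => ?_
  refine Runs.op_seq h9 ((4 * (2 ^ (n + k)) ^ 2) ^ 2) (by simp [Op.eval]; ring)
    (by rw [e4, ← pow_mul]; exact hlt _ (by omega)) fun h10 => ?_
  refine Runs.op h10 ((4 * (2 ^ (n + k)) ^ 2) ^ 3) (by simp [Op.eval]; ring)
    (by rw [e4, ← pow_mul]; exact hlt _ (by omega)) fun _ => ?_
  exact ⟨by simp, by simp, by simp [h2τ]⟩

/-- Processes one outcome: scans its continued fraction and updates the least common multiple in
register `7`. Register `3` holds `d`, and `4` the number of outcomes that are left. -/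
def postStep : Prog :=
  .seq (.op .sub 4 4 5) (.seq (.load 9 4) (.seq (.op .add 8 3 20) (.seq (.const 10 1)
    (.seq (.const 11 0) (.seq (.const 12 1) (.seq euclidProg (.seq (.op .add 17 12 20)
    (.seq (.op .mod 9 7 17) (.seq (.op .add 8 17 20) (.seq (.const 10 1) (.seq (.const 11 0)
    (.seq euclidProg (.seq (.op .mul 13 7 17) (.op .div 7 13 8))))))))))))))

/-- Computes `N = 2 ^ n` and the least common multiple of the denominators. -/
def postProg : Prog :=
  .seq (.const 5 1) (.seq (.op .add 16 0 20) (.seq (.const 6 1) (.seq powProg (.seq (.const 7 1)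
    (.seq (.loop 4 postStep) (.op .add 0 7 20))))))

/-- The cost of `postStep` on `S`-bit numbers. -/
def postStepCost {R : Type*} [CommSemiring R] (S : R) : R :=
  13 * (1 + 3 * S) + 2 * euclidCost S

/-- The cost of `postProg` on `S`-bit numbers for `t` outcomes. -/
def postCost {R : Type*} [CommSemiring R] (S n t : R) : R :=
  5 * (1 + 3 * S) + powCost S n + (t * (1 + S + postStepCost S) + 1)

lemma postStep_runs {S d m N L i s : ℕ} {σ : Store} (hσ : σ.Bounded S) (h3 : σ.reg 3 = d)
    (h4 : σ.reg 4 = m + 1) (h5 : σ.reg 5 = 1) (h6 : σ.reg 6 = N) (h7 : σ.reg 7 = L)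
    (h20 : σ.reg 20 = 0) (hm : σ.mem m = i) (hi : i < d) (hS : 1 < 2 ^ S)
    (hs : cfScan N d i 1 0 1 = s) (hs0 : 0 < s) (hL : 0 < L) (hLs : L * s < 2 ^ S) :
    Runs S postStep σ (postStepCost S) fun τ =>
      τ.reg 7 = Nat.lcm L s ∧ τ.reg 4 = m ∧
      (τ.reg 3 = d ∧ τ.reg 5 = 1 ∧ τ.reg 6 = N ∧ τ.reg 20 = 0) ∧ τ.mem = σ.mem := by
  have hm2 : m < 2 ^ S := by have := hσ.1 4; omega
  have hd2 : d < 2 ^ S := h3 ▸ hσ.1 3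
  have hs2 : s < 2 ^ S := (Nat.le_mul_of_pos_left s hL).trans_lt hLs
  have hmod : L % s < s := Nat.mod_lt _ hs0
  refine (?_ : Runs _ _ _ _ _).mono (C := (1 + 3 * S) + ((1 + 3 * S) + ((1 + 3 * S) +
    ((1 + 3 * S) + ((1 + 3 * S) + ((1 + 3 * S) + (euclidCost S + ((1 + 3 * S) + ((1 + 3 * S) +
    ((1 + 3 * S) + ((1 + 3 * S) + ((1 + 3 * S) + (euclidCost S + ((1 + 3 * S) +
    (1 + 3 * S)))))))))))))))
    (by simp only [postStepCost]; omega) fun _ _ h => h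
  refine Runs.op_seq hσ m (by simp [Op.eval, h4, h5]) hm2 fun b1 => ?_
  refine Runs.load_seq b1 i (by simp [hm]) fun b2 => ?_
  refine Runs.op_seq b2 d (by simp [Op.eval, h3, h20]) hd2 fun b3 => ?_
  refine Runs.const_seq b3 hS fun b4 => ?_
  refine Runs.const_seq b4 (by omega) fun b5 => ?_
  refine Runs.const_seq b5 hS fun b6 => ?_
  refine Runs.seq (euclidProg_runs b6 (by simp [h20]) (by simpa using hi.le)
    (by simpa using hd2)) ?_
  rintro τ hτ ⟨r12, -, hreg, hmem⟩
  simp only [Store.setReg_reg, Nat.reduceEqDiff, if_true, if_false, h6, hs] at r12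
  have r3 : τ.reg 3 = d := by rw [hreg 3 (by decide)]; simp [h3]
  have r4 : τ.reg 4 = m := by rw [hreg 4 (by decide)]; simp
  have r5 : τ.reg 5 = 1 := by rw [hreg 5 (by decide)]; simp [h5]
  have r6 : τ.reg 6 = N := by rw [hreg 6 (by decide)]; simp [h6]
  have r7 : τ.reg 7 = L := by rw [hreg 7 (by decide)]; simp [h7]
  have r20 : τ.reg 20 = 0 := by rw [hreg 20 (by decide)]; simp [h20]
  refine Runs.op_seq hτ s (by simp [Op.eval, r12, r20]) hs2 fun b7 => ?_
  refine Runs.op_seq b7 (L % s) (by simp [Op.eval, r7]) (hmod.trans hs2) fun b8 => ?_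
  refine Runs.op_seq b8 s (by simp [Op.eval, r20]) hs2 fun b9 => ?_
  refine Runs.const_seq b9 hS fun b10 => ?_
  refine Runs.const_seq b10 (by omega) fun b11 => ?_
  refine Runs.seq (euclidProg_runs b11 (by simp [r20]) (by simpa using hmod.le)
    (by simpa using hs2)) ?_
  rintro υ hυ ⟨-, q8, hreg', hmem'⟩
  have q3 : υ.reg 3 = d := by rw [hreg' 3 (by decide)]; simp [r3]
  have q4 : υ.reg 4 = m := by rw [hreg' 4 (by decide)]; simp [r4]
  have q5 : υ.reg 5 = 1 := by rw [hreg' 5 (by decide)]; simp [r5]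
  have q6 : υ.reg 6 = N := by rw [hreg' 6 (by decide)]; simp [r6]
  have q7 : υ.reg 7 = L := by rw [hreg' 7 (by decide)]; simp [r7]
  have q17 : υ.reg 17 = s := by rw [hreg' 17 (by decide)]; simp
  have q20 : υ.reg 20 = 0 := by rw [hreg' 20 (by decide)]; simp [r20]
  have q8' : υ.reg 8 = Nat.gcd L s := by
    rw [q8, Nat.gcd_comm L s, Nat.gcd_rec s L, Nat.gcd_comm (L % s)]
    simp
  refine Runs.op_seq hυ (L * s) (by simp [Op.eval, q7, q17]) hLs fun b12 => ?_
  refine Runs.op b12 (Nat.lcm L s) (by simp [Op.eval, q8', Nat.lcm])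
    ((Nat.div_le_self _ _).trans_lt hLs) fun _ => ?_
  exact ⟨by simp, by simp [q4], ⟨by simp [q3], by simp [q5], by simp [q6], by simp [q20]⟩,
    hmem'.trans hmem⟩

lemma cfDenom_pos {N : ℕ} (hN : 1 ≤ N) (x : ℝ) : 0 < cfDenom N x := by
  classical
  exact Nat.le_findGreatest hN ⟨0, by simp [Real.convergent_zero]⟩

lemma cfDenom_le (N : ℕ) (x : ℝ) : cfDenom N x ≤ N := by
  classical
  exact Nat.findGreatest_le N

lemma postProg_runs {n k M d t S : ℕ} (hn : n < 2 ^ S) (hk : k < 2 ^ S) (hM : M < 2 ^ S)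
    (hd : d < 2 ^ S) (ht : t < 2 ^ S) (hS : n * (t + 1) < S) (ω : Fin t → Fin d) :
    Runs S postProg (Store.init [n, k, M, d, t] (List.ofFn fun j => (ω j : ℕ))) (postCost S n t)
      fun τ => τ.reg 0 = cfOrder n d ω := by
  have hS1 : 1 < 2 ^ S := Nat.one_lt_two_pow (by omega)
  set σ := Store.init [n, k, M, d, t] (List.ofFn fun j => (ω j : ℕ)) with hσ
  have hmem : ∀ m (hm : m < t), σ.mem m = ω ⟨m, hm⟩ := by
    intro m hm
    change (List.ofFn fun j => (ω j : ℕ)).getD m 0 = _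
    rw [List.getD_eq_getElem _ _ (by simpa using hm)]
    simp
  have b0 : σ.Bounded S := by
    refine Store.init_bounded (by simp [hn, hk, hM, hd, ht]) fun x hx => ?_
    obtain ⟨j, rfl⟩ := (List.mem_ofFn' _ _).mp hx
    exact (ω j).2.trans hd
  have r0 : σ.reg 0 = n := rfl
  have r3 : σ.reg 3 = d := rfl
  have r4 : σ.reg 4 = t := rfl
  have r20 : σ.reg 20 = 0 := rfl
  have hN1 : 1 ≤ 2 ^ n := Nat.one_le_two_pow
  have hNt : ∀ e ≤ t + 1, (2 ^ n) ^ e < 2 ^ S := by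
    intro e he
    rw [← pow_mul]
    exact Nat.pow_lt_pow_right (by norm_num) ((Nat.mul_le_mul_left n he).trans_lt hS)
  set f : ℕ → ℕ := fun m => cfDenom (2 ^ n) ((σ.mem m : ℝ) / d) with hf
  have hlcm : (Finset.range t).lcm f = cfOrder n d ω := by
    refine Nat.dvd_antisymm (Finset.lcm_dvd fun m hm => ?_) (Finset.lcm_dvd fun j _ => ?_)
    · have hm' := Finset.mem_range.mp hm
      simp only [hf, hmem m hm']
      exact Finset.dvd_lcm (f := fun j => cfDenom (2 ^ n) (((ω j : ℕ) : ℝ) / d))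
        (Finset.mem_univ (⟨m, hm'⟩ : Fin t))
    · have := Finset.dvd_lcm (f := f) (Finset.mem_range.mpr j.2)
      simpa only [hf, hmem j j.2] using this
  refine (?_ : Runs _ _ _ _ _).mono (C := (1 + 3 * S) + ((1 + 3 * S) + ((1 + 3 * S) +
    (powCost S n + ((1 + 3 * S) + ((t * (1 + S + postStepCost S) + 1) + (1 + 3 * S)))))))
    (by simp only [postCost]; omega) fun _ _ h => h
  refine Runs.const_seq b0 hS1 fun b1 => ?_
  refine Runs.op_seq b1 n (by simp [Op.eval, r0, r20]) hn fun b2 => ?_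
  refine Runs.const_seq b2 hS1 fun b3 => ?_
  refine Runs.seq (powProg_runs (m := n) b3 (by simp) (by simp) (by simp)
    (by simpa using hNt 1 (by omega))) ?_
  rintro τ hτ ⟨hpow, hreg, hmemτ⟩
  have s3 : τ.reg 3 = d := by rw [hreg 3 (by decide) (by decide)]; simp [r3]
  have s4 : τ.reg 4 = t := by rw [hreg 4 (by decide) (by decide)]; simp [r4]
  have s5 : τ.reg 5 = 1 := by rw [hreg 5 (by decide) (by decide)]; simp
  have s20 : τ.reg 20 = 0 := by rw [hreg 20 (by decide) (by decide)]; simp [r20]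
  refine Runs.const_seq hτ hS1 fun b4 => ?_
  refine Runs.seq (Runs.loop (fun m υ => υ.reg 4 = m ∧ m ≤ t ∧ 0 < υ.reg 7 ∧
    υ.reg 7 * (2 ^ n) ^ m ≤ (2 ^ n) ^ t ∧
    Nat.lcm (υ.reg 7) ((Finset.range m).lcm f) = cfOrder n d ω ∧
    (υ.reg 3 = d ∧ υ.reg 5 = 1 ∧ υ.reg 6 = 2 ^ n ∧ υ.reg 20 = 0) ∧ υ.mem = σ.mem)
    (C := postStepCost S) ?_ t _ b4
    ⟨by simp [s4], le_rfl, by simp, by simp, by simp [hlcm],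
      ⟨by simp [s3], by simp [s5], by simp [hpow], by simp [s20]⟩, hmemτ⟩) ?_
  · rintro I υ hυ ⟨u4, hIt, u7, hbound, hl, ⟨u3, u5, u6, u20⟩, um⟩ hne
    obtain ⟨m, rfl⟩ := Nat.exists_eq_succ_of_ne_zero (u4 ▸ hne)
    have hm : m < t := hIt
    have hi : σ.mem m < d := by rw [hmem m hm]; exact (ω ⟨m, hm⟩).2
    have hfN : f m ≤ 2 ^ n := cfDenom_le _ _
    have hf0 : 0 < f m := cfDenom_pos hN1 _
    have hL : υ.reg 7 * f m ≤ υ.reg 7 * 2 ^ n := Nat.mul_le_mul_left _ hfN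
    have hb : (υ.reg 7 * 2 ^ n) * (2 ^ n) ^ m ≤ (2 ^ n) ^ t := by
      rw [mul_assoc, ← pow_succ']; exact hbound
    refine ⟨m, rfl, (postStep_runs hυ u3 u4 u5 u6 rfl u20 (by rw [um]) hi hS1
      (cfScan_eq_cfDenom hN1 hi) hf0 u7 ?_).mono le_rfl ?_⟩
    · refine lt_of_le_of_lt ?_ (hNt t (by omega))
      exact (hL.trans (Nat.le_mul_of_pos_right _ (by positivity))).trans hb
    · rintro χ - ⟨c7, c4, c, cm⟩
      refine ⟨c4, hm.le, ?_, ?_, ?_, c, cm.trans um⟩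
      · rw [c7]; exact Nat.lcm_pos u7 hf0
      · rw [c7]
        refine le_trans (Nat.mul_le_mul_right _ ?_) hb
        exact (Nat.le_of_dvd (Nat.mul_pos u7 hf0) (Nat.lcm_dvd_mul _ _)).trans hL
      · rw [c7, ← hl, Nat.succ_eq_add_one, Finset.range_add_one, Finset.lcm_insert, Nat.lcm_assoc]
        rfl
  · rintro υ hυ ⟨h0, I, u4, -, -, -, hl, ⟨-, -, -, u20⟩, -⟩
    obtain rfl : I = 0 := u4.symm.trans h0
    have h7 : υ.reg 7 = cfOrder n d ω := by simpa using hl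
    exact Runs.op hυ (υ.reg 7) (by simp [Op.eval, u20]) (hυ.1 7) fun _ => by simp [h7]

/-! ### Resource bounds -/

/-- A bound for the bit lengths of all numbers that occur on inputs with `n + k = s`. -/
def bitBound {R : Type*} [CommSemiring R] (s : R) : R := 6 * s + 8 + s * (3 * (s + 1) + 1)

/-- A bound for the total time, and for the bit lengths, on inputs with `n + k = s`. -/
def totalCost {R : Type*} [CommSemiring R] (s : R) : R :=
  11 * (1 + 3 * bitBound s) + powCost (bitBound s) s + 3 * (s + 1) * 5 +
    postCost (bitBound s) s (3 * (s + 1)) + bitBound s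

lemma eval_totalCost (s : ℕ) : (totalCost (Polynomial.X : Polynomial ℕ)).eval s = totalCost s := by
  simp [totalCost, bitBound, powCost, postCost, postStepCost, euclidCost, euclidStepCost]

lemma card_le_two_pow {B : Type*} {n : ℕ} (e : B ↪ (Fin n → Bool)) : Nat.card B ≤ 2 ^ n := by
  simpa using Nat.card_le_card_of_injective e e.injective

end BBN

theorem mainTheorem3 :
    (∃ (pre post : BBN.Prog) (q : Polynomial ℕ), ∀ n k : ℕ, ∃ M d t c₁ c₂ : ℕ,
      (∃ σ : BBN.Store, BBN.Exec pre (BBN.Store.init [n, k] []) σ c₁ ∧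
        σ.reg 0 = M ∧ σ.reg 1 = d ∧ σ.reg 2 = t) ∧
      (∀ ω : Fin t → Fin d, ∃ (σ : BBN.Store) (c : ℕ), c ≤ c₂ ∧
        BBN.Exec post (BBN.Store.init [n, k, M, d, t] (List.ofFn fun j => (ω j : ℕ))) σ c ∧
        σ.reg 0 = BBN.cfOrder n d ω) ∧
      1 ≤ d ∧ Nat.log 2 d ≤ q.eval (n + k) ∧ Nat.log 2 M ≤ q.eval (n + k) ∧
      ∀ (B : Type*) [CommGroup B] [Finite B], (B ↪ (Fin n → Bool)) →
        BBN.IsApproxFourierState d 0 (1 : B) (BBN.approxZero B M) ∧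
        ∀ a : B,
          c₁ + t * (BBN.shorCircuit a).time + c₂ ≤ q.eval (n + k) ∧
          1 - (1 / 2 : ℝ) ^ k ≤ BBN.successProb n M d t a) ∧
    (∀ (B : Type*) [CommGroup B] [Finite B] (a x : B) (M L : ℕ) (k : ℤ),
      L = {m : ℤ | |m| ≤ M ∧ a ^ m = x}.ncard →
      (L : ℝ) / (2 * M + 1) * (4 / (Real.pi ^ 2 * orderOf a)) ≤
        (BBN.measureT (BBN.shorOutput a M)).real
          {g | g.2 = BBN.BReg.of x ∧
            ‖g.1 - (((k : ℝ) / orderOf a : ℝ) : UnitAddCircle)‖ ≤ 1 / (2 * L * orderOf a)}) := by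
  refine ⟨⟨BBN.preProg, BBN.postProg, BBN.totalCost Polynomial.X, fun n k => ?_⟩,
    fun B _ _ a x M L k hL => BBN.le_measureT_shorOutput_closedBall a x M L k hL⟩
  rw [BBN.eval_totalCost]
  set s := n + k with hs
  set S := BBN.bitBound s with hSdef
  set d := 4 * (2 ^ s) ^ 2 with hd
  set t := 3 * (s + 1) with ht
  have hS : S = 6 * s + 8 + s * (t + 1) := rfl
  have hd2 : d = 2 ^ (2 * s + 2) := by
    rw [hd, ← pow_mul, pow_add]; ring
  have hM2 : d ^ 3 = 2 ^ (6 * s + 6) := by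
    rw [hd2, ← pow_mul]; ring_nf
  have hSs : 6 * s + 8 ≤ S := by rw [hS]; exact Nat.le_add_right _ _
  have hlt : ∀ e ≤ 6 * s + 6, 2 ^ e < 2 ^ S := fun e he =>
    Nat.pow_lt_pow_right (by norm_num) (by omega)
  have hs2 : s < 2 ^ s := Nat.lt_two_pow_self
  have hs3 := hlt s (by omega)
  have htS : t < 2 ^ S := by
    have := hlt (s + 2) (by omega)
    rw [pow_add] at this
    omega
  obtain ⟨σ, c₁, hex, hc₁, -, hM, hdσ, htσ⟩ :=
    BBN.preProg_runs (n := n) (k := k) (S := S) (by omega)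
  refine ⟨d ^ 3, d, t, c₁, BBN.postCost S n t, ⟨σ, hex, hM, hdσ, htσ⟩, fun ω => ?_,
    Nat.one_le_iff_ne_zero.mpr (by positivity), ?_, ?_, fun B _ _ e => ?_⟩
  · have hnt : n * (t + 1) ≤ s * (t + 1) := Nat.mul_le_mul_right _ (by omega)
    obtain ⟨τ, c, h1, h2, -, h4⟩ := BBN.postProg_runs (n := n) (k := k) (M := d ^ 3) (d := d)
      (t := t) (S := S) (by omega) (by omega) (by rw [hM2]; exact hlt _ le_rfl)
      (by rw [hd2]; exact hlt _ (by omega)) htS (by omega) ω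
    exact ⟨τ, c, h2, h1, h4⟩
  · rw [hd2, Nat.log_pow (by norm_num)]
    have : S ≤ BBN.totalCost s := Nat.le_add_left _ _
    omega
  · rw [hM2, Nat.log_pow (by norm_num)]
    have : S ≤ BBN.totalCost s := Nat.le_add_left _ _
    omega
  · have hcard := BBN.card_le_two_pow e
    have hns : 2 ^ n ≤ 2 ^ s := Nat.pow_le_pow_right (by norm_num) (by omega)
    have hN1 : 1 ≤ 2 ^ n := Nat.one_le_two_pow
    have hd0 : 0 < d := by positivity
    refine ⟨BBN.isApproxFourierState_approxZero hd0 ?_, fun a => ⟨?_, ?_⟩⟩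
    · have h1 : 3 * Nat.card B ≤ 2 * d := by
        rw [hd]; nlinarith
      calc 3 * Nat.card B * d ^ 2 ≤ 2 * d * d ^ 2 := Nat.mul_le_mul_right _ h1
        _ ≤ 2 * d ^ 3 + 1 := by rw [pow_succ d 2]; nlinarith
    · have h1 : (BBN.shorCircuit a).time = 5 := rfl
      have h2 : BBN.postCost S n t ≤ BBN.postCost S s t := by
        have : n ≤ s := by omega
        unfold BBN.postCost BBN.powCost
        gcongr
      rw [← hs] at hc₁
      rw [h1]
      change _ ≤ 11 * (1 + 3 * S) + BBN.powCost S s + t * 5 + BBN.postCost S s t + S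
      omega
    · have h := BBN.one_sub_half_pow_le n k rfl
      refine h.trans (BBN.le_successProb a hcard ?_ ?_ ?_)
      · rw [hd]
        have := Nat.pow_le_pow_left hns 2
        omega
      · have hc : (Nat.card B : ℝ) ≤ 2 ^ n := by exact_mod_cast hcard
        have hdr : (0 : ℝ) < d := by exact_mod_cast hd0
        have h3 : (Nat.card B : ℝ) * (d : ℝ) ^ 2 / (4 * (2 * ((d ^ 3 : ℕ) : ℝ) + 1)) ≤
            2 ^ n * (d : ℝ) ^ 2 / (4 * (2 * (d : ℝ) ^ 3)) := by
          push_cast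
          gcongr
          linarith
        refine h3.trans (le_of_eq ?_)
        have h4 : (d : ℝ) = 4 * (2 ^ (n + k)) ^ 2 := by rw [hd, hs]; push_cast; rfl
        have h5 : (2 : ℝ) ^ n * (d : ℝ) ^ 2 / (4 * (2 * (d : ℝ) ^ 3)) = 2 ^ n / (8 * (d : ℝ)) := by
          field_simp; norm_num
        rw [h5, h4]
        congr 1
        ring
      · rw [div_le_one (by positivity), ← hs]
        have h1 : (2 : ℝ) ^ n ≤ 2 ^ s := by exact_mod_cast hns
        have h2 : (1 : ℝ) ≤ 2 ^ s := one_le_pow₀ (by norm_num)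
        nlinarith
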